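/- Definitions. A deterministic object type is given by a set of states, a set of operations (including their arguments) and, for each state and operation, a unique next state and a unique response; it is readable if it has an operation that never changes the state and whose response identifies the entire current state. Processes are deterministic and asynchronous and communicate by applying atomic operations to (possibly infinitely many) non-volatile shared objects whose initial states are chosen by the algorithm. Any process may individually crash at any time, any number of times; a crash resets its local state to the initial state, so that it restarts its code with the same input, and leaves the shared objects unchanged. Fix a set $V$ of possible inputs with at least two elements. An algorithm solves recoverable consensus (RC) among $n$ processes, each with an input in $V$, if in every execution (a) no two outputs differ, including outputs of different runs of the same process; (b) every output is the input of some process; (c) a process that executes its code from the beginning either crashes or produces an output after finitely many of its own steps. For a set $\mathcal T$ of types, $rcons(\mathcal T)\in\mathbb N\cup\{\infty\}$ is the maximum number of processes that can solve RC using objects of types in $\mathcal T$ together with read/write registers, or $\infty$ if there is no such maximum; $rcons(T)=rcons(\{T\})$. Theorem. Let $\mathcal T$ be a non-empty set of deterministic, readable types. If $n=\max\{rcons(T) : T\in\mathcal T\}$ exists, then $n\le rcons(\mathcal T)\le n+1$ (with $\infty+1=\infty$, if the maximum is $\infty$). If $\max\{rcons(T) : T\in\mathcal T\}$ does not exist,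 then $rcons(\mathcal T)=\infty$. -/

import Mathlib

universe u

/-- A deterministic shared object type: its sequential specification gives, for each state and each
operation (an operation includes its arguments), a unique next state and a unique response. -/
structure ObjType : Type (u + 1) where
  State : Type u
  Op : Type u
  Resp : Type u
  next : State → Op → State
  resp : State → Op → Resp

/-- A type is readable if one of its operations never changes the state and its response
identifies the entire current state. -/
def ObjType.Readable (T : ObjType.{u}) : Prop :=
  ∃ read : T.Op, (∀ q, T.next q read = q) ∧ Function.Injective fun q => T.resp q read

/-- The operations of a read/write register with contents in `α`. -/
inductive RegOp (α : Type u) : Type u where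
  | read : RegOp α
  | write (a : α) : RegOp α

/-- The read/write register with contents in `α`. A read returns the contents, a write stores its
argument and returns an acknowledgement (`none`). -/
def registerType (α : Type u) : ObjType.{u} where
  State := α
  Op := RegOp α
  Resp := Option α
  next q op := match op with
    | .read => q
    | .write a => a
  resp q op := match op with
    | .read => some q
    | .write _ => none

/-- All register types. -/
def registers : Set ObjType.{u} := Set.range registerType

/-- What a process does next, as determined by its local state: it has returned a value, or it
applies an operation to a shared object and moves to a local state that depends on the response. -/
inductive NextAction (V : Type u) {Obj : Type u} (kind : Obj → ObjType.{u}) (Loc : Type u) :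
    Type u where
  | output (v : V) : NextAction V kind Loc
  | invoke (o : Obj) (op : (kind o).Op) (k : (kind o).Resp → Loc) : NextAction V kind Loc

/-- An `n`-process algorithm with inputs and outputs in `V` using shared objects of types in `𝒯`.
There may be infinitely many objects; each starts in a state that the algorithm prescribes. -/
structure Algorithm (V : Type u) (𝒯 : Set ObjType.{u}) (n : ℕ) : Type (u + 1) where
  Obj : Type u
  kind : Obj → ObjType.{u}
  kind_mem : ∀ o, kind o ∈ 𝒯
  initShared : ∀ o, (kind o).State
  Loc : Type u
  initLocal : Fin n → V → Loc
  action : Fin n → Loc → NextAction V kind Loc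

/-- An event of an execution: a step of a process, or the crash (and restart) of a process. -/
inductive Event (n : ℕ) : Type where
  | step (p : Fin n) : Event n
  | crash (p : Fin n) : Event n

namespace Algorithm

variable {V : Type u} {𝒯 : Set ObjType.{u}} {n : ℕ}

/-- A configuration: the local states of the processes and the states of the shared objects. -/
structure Config (A : Algorithm V 𝒯 n) : Type u where
  loc : Fin n → A.Loc
  shared : ∀ o, (A.kind o).State

open Classical in
/-- The effect of an event. A step of a process performs its next operation atomically (and does
nothing if the current run of the process has already returned a value). A crash resets the local
state of one process to its initial state and leaves the shared memory unchanged. -/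
noncomputable def exec (A : Algorithm V 𝒯 n) (input : Fin n → V) (c : A.Config) :
    Event n → A.Config
  | .step p =>
    match A.action p (c.loc p) with
    | .output _ => c
    | .invoke o op k =>
      { loc := Function.update c.loc p (k ((A.kind o).resp (c.shared o) op))
        shared := Function.update c.shared o ((A.kind o).next (c.shared o) op) }
  | .crash p => { c with loc := Function.update c.loc p (A.initLocal p (input p)) }

/-- The configuration after the first `t` events of the schedule `σ`. -/
noncomputable def config (A : Algorithm V 𝒯 n) (input : Fin n → V) (σ : ℕ → Event n) :
    ℕ → A.Config
  | 0 => { loc := fun p => A.initLocal p (input p), shared := A.initShared }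
  | t + 1 => A.exec input (A.config input σ t) (σ t)

/-- After `t` events of the schedule `σ`, the current run of `p` has returned `v`. -/
def Outputs (A : Algorithm V 𝒯 n) (input : Fin n → V) (σ : ℕ → Event n) (t : ℕ) (p : Fin n)
    (v : V) : Prop :=
  A.action p ((A.config input σ t).loc p) = .output v

/-- The algorithm solves recoverable consensus when independent crashes may occur. The input of a
process stays the same in all its runs. -/
structure SolvesRC (A : Algorithm V 𝒯 n) : Prop where
  /-- No two outputs in an execution differ, including outputs in several runs of one process. -/
  agreement : ∀ (input : Fin n → V) (σ : ℕ → Event n) (s t : ℕ) (p q : Fin n) (v w : V),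
    A.Outputs input σ s p v → A.Outputs input σ t q w → v = w
  /-- Each output is the input of some process. -/
  validity : ∀ (input : Fin n → V) (σ : ℕ → Event n) (t : ℕ) (p : Fin n) (v : V),
    A.Outputs input σ t p v → ∃ q, v = input q
  /-- A process that from some time on takes infinitely many steps and never crashes produces an
  output in its last run. -/
  waitFree : ∀ (input : Fin n → V) (σ : ℕ → Event n) (p : Fin n) (t₀ : ℕ),
    (∀ t, t₀ ≤ t → σ t ≠ .crash p) → {t | σ t = .step p}.Infinite →
      ∃ t v, t₀ ≤ t ∧ A.Outputs input σ t p v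

end Algorithm

/-- `n` processes can solve recoverable consensus with inputs in `V`, with independent crashes,
using objects of the types in `𝒯` and registers. -/
def RCSolvable (V : Type u) (𝒯 : Set ObjType.{u}) (n : ℕ) : Prop :=
  ∃ A : Algorithm V (𝒯 ∪ registers) n, A.SolvesRC

/-- The (independent) recoverable consensus number of a set of types: the maximum number of
processes that can solve recoverable consensus, or `∞` if there is no maximum. -/
noncomputable def rcons (V : Type u) (𝒯 : Set ObjType.{u}) : ℕ∞ :=
  sSup {m : ℕ∞ | ∃ n : ℕ, m = n ∧ RCSolvable V 𝒯 n}

/-! The lower bound holds because an algorithm for a subset of the types is also one for the whole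
set. The upper bound comes from a property of a single type, `ObjType.IsRecording`: from a suitable
state, one operation per role can be assigned so that the current state tells which of two teams
acted first, even though one team may be able to restore the initial state. It is necessary and
sufficient for consensus up to a loss of one process: if `n + 1 ≥ 3` processes can solve the
problem, some object used has a type that is recording for `n` roles; and a readable type that is
recording for `n` roles solves the problem for `n` processes on its own, with registers. So a whole
set of types gains at most one process over its best member.

Necessity (`Algorithm.SolvesRC.exists_isRecording`) is a valency argument. If crashes were
unrestricted, a bivalent execution could go on forever, each process crashing infinitely often,
without contradicting termination. Crashes are therefore paid for by steps of processes of smaller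
index: then every infinite execution has a process that steps forever and eventually stops crashing
(`exists_fair_process`), which must output, so a critical configuration exists (`exists_critical`).
There all processes are about to access one object. Indistinguishability, for a process that has not
moved or for one that has just crashed, restricts which orders of operations can lead to the same
state. `ObjType.exists_isRecording_of_forall` extracts a recording structure from these restrictions
after deleting one process.

Sufficiency (`ObjType.IsRecording.rcSolvable`) plays matches between two teams, each team proposing
one common value. A process that sees the object in its initial state applies its operation;
otherwise the state reveals the winner. The danger is a restored initial state, which looks like an
unplayed match. Only team `true` can restore it acting first, and only with the help of every member
of team `false` (`ObjType.IsRecording.mem_of_run_eq`). When restoration is possible, team `false` is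
a single role, which gives up if it sees a value of the other team. Matches are arranged in a
bracket so that each team reaches a common value before it has to propose one. -/

namespace Algorithm

variable {V : Type u} {𝒯 : Set ObjType.{u}} {n : ℕ}

/-! ### Single events and finite schedules -/

section Exec

variable (A : Algorithm V 𝒯 n) (input : Fin n → V)

theorem exec_step_of_output {c : A.Config} {p : Fin n} {v : V}
    (h : A.action p (c.loc p) = .output v) : A.exec input c (.step p) = c := by
  simp only [exec, h]

theorem exec_step_loc_self {c : A.Config} {p : Fin n} {o : A.Obj} {op : (A.kind o).Op}
    {k : (A.kind o).Resp → A.Loc} (h : A.action p (c.loc p) = .invoke o op k) :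
    (A.exec input c (.step p)).loc p = k ((A.kind o).resp (c.shared o) op) := by
  simp [exec, h]

theorem exec_step_shared_self {c : A.Config} {p : Fin n} {o : A.Obj} {op : (A.kind o).Op}
    {k : (A.kind o).Resp → A.Loc} (h : A.action p (c.loc p) = .invoke o op k) :
    (A.exec input c (.step p)).shared o = (A.kind o).next (c.shared o) op := by
  simp [exec, h]

theorem exec_step_shared_of_ne {c : A.Config} {p : Fin n} {o : A.Obj} {op : (A.kind o).Op}
    {k : (A.kind o).Resp → A.Loc} (h : A.action p (c.loc p) = .invoke o op k) {o' : A.Obj}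
    (ho : o' ≠ o) : (A.exec input c (.step p)).shared o' = c.shared o' := by
  simp [exec, h, ho]

theorem exec_step_loc_of_ne (c : A.Config) {p q : Fin n} (h : q ≠ p) :
    (A.exec input c (.step p)).loc q = c.loc q := by
  cases hp : A.action p (c.loc p) <;> simp [exec, hp, h]

theorem exec_crash_loc_self (c : A.Config) (p : Fin n) :
    (A.exec input c (.crash p)).loc p = A.initLocal p (input p) := by
  simp [exec]

theorem exec_crash_loc_of_ne (c : A.Config) {p q : Fin n} (h : q ≠ p) :
    (A.exec input c (.crash p)).loc q = c.loc q := by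
  simp [exec, h]

theorem exec_crash_shared (c : A.Config) (p : Fin n) :
    (A.exec input c (.crash p)).shared = c.shared := by
  simp [exec]

theorem Config.ext' {A : Algorithm V 𝒯 n} {c d : A.Config} (hl : ∀ p, c.loc p = d.loc p)
    (hs : ∀ o, c.shared o = d.shared o) : c = d := by
  cases c; cases d
  congr
  · exact funext hl
  · exact funext hs

/-- The configuration after a finite list of events, starting from `c`. -/
noncomputable def execList (c : A.Config) (l : List (Event n)) : A.Config :=
  l.foldl (A.exec input) c

/-- The initial configuration. -/
def initial : A.Config where
  loc p := A.initLocal p (input p)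
  shared := A.initShared

@[simp] theorem execList_nil (c : A.Config) : A.execList input c [] = c := rfl

@[simp] theorem execList_cons (c : A.Config) (e : Event n) (l : List (Event n)) :
    A.execList input c (e :: l) = A.execList input (A.exec input c e) l := rfl

theorem execList_append (c : A.Config) (l l' : List (Event n)) :
    A.execList input c (l ++ l') = A.execList input (A.execList input c l) l' := by
  simp [execList]

theorem config_eq_execList (σ : ℕ → Event n) (t : ℕ) :
    A.config input σ t = A.execList input (A.initial input) ((List.range t).map σ) := by
  induction t with
  | zero => rfl
  | succ t ih => simp [config, List.range_succ, execList_append, ih]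

end Exec

theorem map_range_getD {α : Type*} (l : List α) (a : α) (k : ℕ) :
    (List.range (l.length + k)).map (fun i => l.getD i a) = l ++ List.replicate k a := by
  apply List.ext_getElem
  · simp
  · intro i h1 h2
    by_cases hi : i < l.length
    · simp [hi, List.getElem_append_left]
    · simp [List.getElem_append_right (not_lt.mp hi), List.getElem?_eq_none (not_lt.mp hi)]

/-- Correctness is stated for infinite schedules, the valency argument uses finite lists. Padding a
list with one repeated event links the two. -/
theorem config_getD (A : Algorithm V 𝒯 n) (input : Fin n → V) (l : List (Event n)) (e : Event n)
    (k : ℕ) : A.config input (fun i => l.getD i e) (l.length + k) =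
      A.execList input (A.initial input) (l ++ List.replicate k e) := by
  rw [config_eq_execList, map_range_getD]

theorem config_getD_append (A : Algorithm V 𝒯 n) (input : Fin n → V) (l l' : List (Event n))
    (e : Event n) : A.config input (fun i => (l ++ l').getD i e) l.length =
      A.execList input (A.initial input) l := by
  rw [config_eq_execList]
  congr 1
  apply List.ext_getElem
  · simp
  · intro i h1 h2
    simp [List.getElem?_append_left h2, h2]

/-- Processes with the same local state that see the same shared memory cannot tell two
configurations apart while no other process takes steps. -/
theorem solo_congr (A : Algorithm V 𝒯 n) (input input' : Fin n → V) (p : Fin n) (k : ℕ) :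
    ∀ {c c' : A.Config}, c.loc p = c'.loc p → c.shared = c'.shared →
    (A.execList input c (List.replicate k (.step p))).loc p =
        (A.execList input' c' (List.replicate k (.step p))).loc p ∧
      (A.execList input c (List.replicate k (.step p))).shared =
        (A.execList input' c' (List.replicate k (.step p))).shared := by
  induction k with
  | zero => intro c c' h hs; exact ⟨h, hs⟩
  | succ k ih =>
    intro c c' h hs
    simp only [List.replicate_succ, execList_cons]
    cases hp : A.action p (c.loc p) with
    | output v =>
      rw [exec_step_of_output A input hp, exec_step_of_output A input' (h ▸ hp)]
      exact ih h hs
    | invoke o op f =>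
      have hp' : A.action p (c'.loc p) = .invoke o op f := h ▸ hp
      apply ih
      · rw [exec_step_loc_self A input hp, exec_step_loc_self A input' hp', hs]
      · funext o'
        by_cases ho : o' = o
        · subst ho
          rw [exec_step_shared_self A input hp, exec_step_shared_self A input' hp', hs]
        · rw [exec_step_shared_of_ne A input hp ho, exec_step_shared_of_ne A input' hp' ho, hs]

/-! ### Correctness along finite schedules -/

namespace SolvesRC

variable {A : Algorithm V 𝒯 n} (h : A.SolvesRC) (input : Fin n → V)
include h

theorem agreement_list {l l' : List (Event n)} {p q : Fin n} {v w : V}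
    (hv : A.action p ((A.execList input (A.initial input) l).loc p) = .output v)
    (hw : A.action q ((A.execList input (A.initial input) (l ++ l')).loc q) = .output w) :
    v = w := by
  refine h.agreement input (fun i => (l ++ l').getD i (.step p)) l.length ((l ++ l').length + 0)
    p q v w ?_ ?_
  · rw [Outputs, config_getD_append]; exact hv
  · rw [Outputs, config_getD]; simpa using hw

theorem validity_list {l : List (Event n)} {p : Fin n} {v : V}
    (hv : A.action p ((A.execList input (A.initial input) l).loc p) = .output v) :
    ∃ q, v = input q := by
  refine h.validity input (fun i => l.getD i (.step p)) (l.length + 0) p v ?_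
  rw [Outputs, config_getD]; simpa using hv

/-- The schedule `l` padded with steps of `p` contains no crash after `l`, so termination applies to
it. -/
theorem solo_terminates (l : List (Event n)) (p : Fin n) : ∃ k v,
    A.action p ((A.execList input (A.execList input (A.initial input) l)
      (List.replicate k (.step p))).loc p) = .output v := by
  have hget : ∀ t, l.length ≤ t → l.getD t (.step p) = .step p := fun t ht =>
    List.getD_eq_default _ _ ht
  obtain ⟨t, v, ht, hv⟩ := h.waitFree input (fun i => l.getD i (.step p)) p l.length
    (fun t ht => by simp only [hget t ht]; simp)
    ((Set.Ici_infinite l.length).mono fun t ht => hget t ht)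
  obtain ⟨k, rfl⟩ := Nat.exists_eq_add_of_le ht
  refine ⟨k, v, ?_⟩
  rw [Outputs, config_getD, execList_append] at hv
  exact hv

end SolvesRC

/-! ### Crash budgets -/

/-- Budgets for crashes: each step of a process pays for one crash of each process of larger
index, and a crash uses up one unit of the budget of the crashed process. -/
def recharge (b : Fin n → ℕ) : Event n → Fin n → ℕ
  | .step p, q => if p < q then b q + 1 else b q
  | .crash p, q => if q = p then b q - 1 else b q

/-- Steps are always affordable, a crash requires a positive budget. -/
def Affordable (b : Fin n → ℕ) : Event n → Prop
  | .step _ => True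
  | .crash p => 0 < b p

/-- All events of the list are affordable when they occur. -/
def AffordableList (b : Fin n → ℕ) : List (Event n) → Prop
  | [] => True
  | e :: l => Affordable b e ∧ AffordableList (recharge b e) l

theorem affordableList_steps (b : Fin n → ℕ) (L : List (Fin n)) :
    AffordableList b (L.map .step) := by
  induction L generalizing b with
  | nil => trivial
  | cons p L ih => exact ⟨trivial, ih _⟩

theorem affordableList_append (b : Fin n → ℕ) (l l' : List (Event n)) :
    AffordableList b (l ++ l') ↔ AffordableList b l ∧ AffordableList (l.foldl recharge b) l' := by
  induction l generalizing b with
  | nil => simp [AffordableList]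
  | cons e l ih => simp [AffordableList, ih, and_assoc]

theorem le_foldl_recharge_steps (b : Fin n → ℕ) (L : List (Fin n)) (q : Fin n) :
    b q ≤ (L.map .step).foldl recharge b q := by
  induction L generalizing b with
  | nil => simp
  | cons p L ih =>
    refine le_trans ?_ (ih _)
    simp only [recharge]
    split <;> omega

/-- This makes a crash of `q` affordable right after a block of steps in which a process of smaller
index took part. -/
theorem foldl_recharge_steps_pos (b : Fin n → ℕ) {L : List (Fin n)} {p q : Fin n} (hp : p ∈ L)
    (hpq : p < q) : 0 < (L.map .step).foldl recharge b q := by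
  induction L generalizing b with
  | nil => simp at hp
  | cons r L ih =>
    rcases List.mem_cons.mp hp with rfl | hp
    · refine lt_of_lt_of_le ?_ (le_foldl_recharge_steps _ L q)
      simp [recharge, hpq]
    · exact ih _ hp

/-- In an infinite affordable execution some process takes infinitely many steps but crashes only
finitely often. -/
theorem exists_fair_process (e : ℕ → Event n) (b : ℕ → Fin n → ℕ)
    (hb : ∀ t, b (t + 1) = recharge (b t) (e t)) (he : ∀ t, Affordable (b t) (e t)) :
    ∃ p t₀, (∀ t, t₀ ≤ t → e t ≠ .crash p) ∧ {t | e t = .step p}.Infinite := by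
  classical
  let proc : Event n → Fin n := fun e => match e with | .step p => p | .crash p => p
  let busy : Set (Fin n) := {p | {t | proc (e t) = p}.Infinite}
  have hbusy : busy.Nonempty := by
    obtain ⟨p, hp⟩ := Finite.exists_infinite_fiber (fun t => proc (e t))
    exact ⟨p, Set.infinite_coe_iff.mp hp⟩
  -- For the least process with infinitely many events, all processes that could fund its crashes
  -- are eventually silent, so its budget stops growing.
  obtain ⟨p, hp, hmin⟩ := WellFounded.has_min wellFounded_lt busy hbusy
  have hfin : ({t | proc (e t) < p} : Set ℕ).Finite := by
    have : ({t | proc (e t) < p} : Set ℕ) = ⋃ q ∈ Set.Iio p, {t | proc (e t) = q} := by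
      ext t; simp
    rw [this]
    refine (Set.toFinite _).biUnion fun q hq => ?_
    by_contra hinf
    exact hmin q hinf hq
  obtain ⟨t₁, ht₁⟩ := hfin.bddAbove
  have hlow : ∀ t, t₁ + 1 ≤ t → ¬ proc (e t) < p := fun t ht hlt => by
    have := ht₁ hlt; omega
  have hdec : ∀ t, t₁ + 1 ≤ t → b (t + 1) p ≤ b t p := fun t ht => by
    have := hlow t ht
    rw [hb]
    cases het : e t with
    | step q =>
      rw [het] at this
      simp only [recharge]
      rw [if_neg this]
    | crash q => simp only [recharge]; split <;> omega
  have hanti : Antitone fun k => b (t₁ + 1 + k) p :=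
    antitone_nat_of_succ_le fun k => hdec (t₁ + 1 + k) (Nat.le_add_right _ _)
  -- Once the budget has reached its minimum, a further crash would push it below.
  obtain ⟨_, ⟨k, rfl⟩, hk⟩ := WellFounded.has_min wellFounded_lt
    (Set.range fun k => b (t₁ + 1 + k) p) ⟨_, 0, rfl⟩
  have hcrash : ∀ t, t₁ + 1 + k ≤ t → e t ≠ .crash p := fun t ht het => by
    have h1 := he t
    have h2 := congrFun (hb t) p
    rw [het] at h1 h2
    simp only [Affordable, recharge, if_true] at h1 h2
    obtain ⟨j, rfl⟩ := Nat.exists_eq_add_of_le ht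
    have h3 := hk _ ⟨k + j + 1, rfl⟩
    have h4 := hanti (Nat.le_add_right k j)
    simp only [← add_assoc] at h3 h4
    omega
  refine ⟨p, t₁ + 1 + k, hcrash, ?_⟩
  have hp' : {t | proc (e t) = p}.Infinite := hp
  refine (hp'.sdiff (Set.finite_lt_nat (t₁ + 1 + k))).mono ?_
  rintro t ⟨ht, hlt⟩
  simp only [Set.mem_ofPred_eq, not_lt] at ht hlt
  cases het : e t with
  | step q => rw [het] at ht; simp only [proc] at ht; subst ht; exact het
  | crash q =>
    rw [het] at ht; simp only [proc] at ht; subst ht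
    exact absurd het (hcrash t hlt)

end Algorithm

/-! ### Recording types -/

namespace ObjType

variable {ι κ : Type*} (T : ObjType.{u})

/-- The state reached from `q` when the operations of the roles in `L` are applied in order. -/
def run (op : ι → T.Op) (q : T.State) (L : List ι) : T.State :=
  L.foldl (fun q i => T.next q (op i)) q

@[simp] theorem run_nil (op : ι → T.Op) (q : T.State) : T.run op q [] = q := rfl

theorem run_append (op : ι → T.Op) (q : T.State) (L L' : List ι) :
    T.run op q (L ++ L') = T.run op (T.run op q L) L' := by
  simp [run]

@[simp] theorem run_singleton (op : ι → T.Op) (q : T.State) (i : ι) :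
    T.run op q [i] = T.next q (op i) := rfl

theorem run_map (f : κ → ι) (op : ι → T.Op) (q : T.State) (L : List κ) :
    T.run op q (L.map f) = T.run (op ∘ f) q L := by
  simp [run, List.foldl_map]

/-- The states reached from `q` by applying operations of distinct roles, the first of which
belongs to team `X`. -/
def FirstBy (op : ι → T.Op) (team : ι → Bool) (q : T.State) (X : Bool) : Set T.State :=
  {r | ∃ i L, team i = X ∧ (i :: L).Nodup ∧ T.run op q (i :: L) = r}

/-- The type `T` records which of two non-empty teams accesses an object first. Whether a team can
bring the object back to its initial state matters: we name the teams such that only team `true`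
may be able to, in which case team `false` has just one member. -/
structure IsRecording (q : T.State) (team : ι → Bool) (op : ι → T.Op) : Prop where
  nonempty : ∀ X, ∃ i, team i = X
  disjoint : ∀ r ∈ T.FirstBy op team q true, r ∉ T.FirstBy op team q false
  fresh : q ∉ T.FirstBy op team q false
  single : q ∈ T.FirstBy op team q true → ∀ i j, team i = false → team j = false → i = j

variable {T}

theorem IsRecording.comp_equiv {q : T.State} {team : ι → Bool} {op : ι → T.Op}
    (h : T.IsRecording q team op) (e : κ ≃ ι) : T.IsRecording q (team ∘ e) (op ∘ e) := by
  have hsub : ∀ X, T.FirstBy (op ∘ e) (team ∘ e) q X ⊆ T.FirstBy op team q X := by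
    rintro X r ⟨i, L, hi, hL, hr⟩
    refine ⟨e i, L.map e, hi, ?_, ?_⟩
    · rw [← List.map_cons]; exact hL.map e.injective
    · rw [← List.map_cons, run_map]; exact hr
  refine ⟨fun X => ?_, fun r hr hr' => h.disjoint r (hsub _ hr) (hsub _ hr'),
    fun hq => h.fresh (hsub _ hq), fun hq i j hi hj => e.injective (h.single (hsub _ hq) _ _ hi hj)⟩
  obtain ⟨i, hi⟩ := h.nonempty X
  exact ⟨e.symm i, by simpa using hi⟩

/-- The hypotheses are what indistinguishability yields at a critical configuration: for a process
that has not moved (`hdisj`, `hret`) and for one that crashes after a process of smaller index has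
moved (`hlow`). Deleting a process `x` leaves an observer that never moves, which gives disjointness
and shows that only the team of `x` can restore `q`. The one obstruction is that this team does
restore `q` while the other team has two members. Deleting one of those two instead can fail only if
the other team restores `q` as well, and two such restorations contradict `hlow`. -/
theorem exists_isRecording_of_forall {V : Type*} {n : ℕ} (hn : 3 ≤ n) (q : T.State)
    (op : Fin n → T.Op) (val : Fin n → V) (hval : ∃ i j, val i ≠ val j)
    (hdisj : ∀ y i L i' L', (i :: L).Nodup → (i' :: L').Nodup → y ∉ i :: L → y ∉ i' :: L' →
      T.run op q (i :: L) = T.run op q (i' :: L') → val i = val i')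
    (hret : ∀ y i L, (i :: L).Nodup → y ∉ i :: L → T.run op q (i :: L) = q → val i = val y)
    (hlow : ∀ z a i L i' L', (i :: L).Nodup → (i' :: L').Nodup → a < z → z ∈ i :: L →
      z ∈ i' :: L' → a ∈ i :: L → a ∈ i' :: L' →
      T.run op q (i :: L) = q → T.run op q (i' :: L') = q → val i = val i') :
    ∃ (x : Fin n) (team : {i // i ≠ x} → Bool),
      T.IsRecording q team (op ∘ Subtype.val) := by
  classical
  obtain ⟨i₀, j₀, hij⟩ := hval
  -- More than two values may occur; all those other than `val i₀` are merged into one team.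
  let t : Fin n → Bool := fun i => decide (val i = val i₀)
  have ht : ∀ {i j}, t i ≠ t j → val i ≠ val j := fun h h' => h (by simp only [t, h'])
  have hbool : ∀ {a b c : Bool}, a ≠ c → b ≠ c → a = b := by decide
  -- The teammate `x'` keeps the team of `x` non-empty after the deletion of `x`.
  have key : ∀ x x', x' ≠ x → t x' = t x →
      (∃ team : {i // i ≠ x} → Bool, T.IsRecording q team (op ∘ Subtype.val)) ∨
      ((∃ i L, (i :: L).Nodup ∧ x ∉ i :: L ∧ t i = t x ∧ T.run op q (i :: L) = q) ∧
        ∃ j j', j ≠ j' ∧ t j ≠ t x ∧ t j' ≠ t x) := by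
    intro x x' hx' htx'
    by_contra! hcon
    obtain ⟨hno, hcon⟩ := hcon
    let team : {i // i ≠ x} → Bool := fun i => decide (t i = t x)
    have hlift : ∀ {X r}, r ∈ T.FirstBy (op ∘ Subtype.val) team q X →
        ∃ i L, (i :: L).Nodup ∧ x ∉ i :: L ∧ decide (t i = t x) = X ∧
          T.run op q (i :: L) = r := by
      rintro X r ⟨i, L, hi, hL, hr⟩
      refine ⟨i, L.map Subtype.val, ?_, ?_, hi, ?_⟩
      · rw [← List.map_cons]; exact hL.map Subtype.val_injective
      · rw [← List.map_cons]; intro hmem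
        obtain ⟨y, _, hy⟩ := List.mem_map.mp hmem
        exact y.2 hy
      · rw [← List.map_cons, run_map]; exact hr
    refine hno team ⟨?_, ?_, ?_, ?_⟩
    · rintro (_ | _)
      · by_cases h : t i₀ = t x
        · have hj : t j₀ ≠ t x := by
            rw [← h]; simpa [t] using Ne.symm hij
          exact ⟨⟨j₀, fun h => hj (h ▸ rfl)⟩, by simpa [team] using hj⟩
        · exact ⟨⟨i₀, fun h' => h (h' ▸ rfl)⟩, by simpa [team] using h⟩
      · exact ⟨⟨x', hx'⟩, by simpa [team] using htx'⟩
    · intro r hr hr'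
      obtain ⟨i, L, hL, hx, hi, hr⟩ := hlift hr
      obtain ⟨i', L', hL', hx', hi', hr'⟩ := hlift hr'
      simp only [decide_eq_true_eq, decide_eq_false_iff_not] at hi hi'
      exact ht (fun h => hi' (h ▸ hi)) (hdisj x i L i' L' hL hL' hx hx' (hr.trans hr'.symm))
    · intro hr
      obtain ⟨i, L, hL, hx, hi, hr⟩ := hlift hr
      simp only [decide_eq_false_iff_not] at hi
      exact ht hi (hret x i L hL hx hr)
    · intro hr i j hi hj
      obtain ⟨i', L, hL, hx, hi', hr⟩ := hlift hr
      simp only [decide_eq_true_eq] at hi'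
      simp only [team, decide_eq_false_iff_not] at hi hj
      by_contra hne
      exact hj (hcon ⟨i', L, hL, hx, hi', hr⟩ i j (fun h => hne (Subtype.ext h)) hi)
  -- Pigeonhole: at least three processes, two teams.
  obtain ⟨x, x', hne, hxx⟩ : ∃ x x', x' ≠ x ∧ t x' = t x := by
    by_contra! h
    have hinj : Function.Injective t := fun a b hab => by
      by_contra hne; exact h b a hne hab
    have := Fintype.card_le_of_injective t hinj
    simp at this
    omega
  rcases key x x' hne hxx with h | ⟨⟨i, L, hL, -, hi, hr⟩, j, j', hjj, hj, hj'⟩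
  · exact ⟨x, h⟩
  rcases key j j' hjj.symm (hbool hj' hj) with h | ⟨⟨i', L', hL', -, hi', hr'⟩, -⟩
  · exact ⟨j, h⟩
  exfalso
  have hii : t i ≠ t i' := by rw [hi, hi']; exact hj.symm
  -- By `hret`, a restoring order must contain every process of the opposite value. Hence both
  -- orders contain both `i` and `i'`, and the larger of the two can be the one that crashes.
  have h1 : i ∈ i' :: L' := by
    by_contra hmem; exact ht hii (hret i i' L' hL' hmem hr').symm
  have h2 : i' ∈ i :: L := by
    by_contra hmem; exact ht hii (hret i' i L hL hmem hr)
  have h3 : i ∈ i :: L := List.mem_cons_self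
  have h4 : i' ∈ i' :: L' := List.mem_cons_self
  rcases lt_trichotomy i i' with hlt | heq | hlt
  · exact ht hii (hlow i' i i L i' L' hL hL' hlt h2 h4 h3 h1 hr hr')
  · exact hii (heq ▸ rfl)
  · exact ht hii (hlow i i' i L i' L' hL hL' hlt h3 h1 h2 h4 hr hr')

end ObjType

/-! ### Critical configurations -/

namespace Algorithm

variable {V : Type u} {𝒯 : Set ObjType.{u}} {n : ℕ}

/-- Some affordable continuation of `c` makes a process return `v`. -/
def Decides (A : Algorithm V 𝒯 n) (input : Fin n → V) (c : A.Config) (b : Fin n → ℕ) (v : V) :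
    Prop :=
  ∃ l, AffordableList b l ∧ ∃ p, A.action p ((A.execList input c l).loc p) = .output v

section

variable {A : Algorithm V 𝒯 n} {input : Fin n → V}

theorem Decides.of_execList {c : A.Config} {b : Fin n → ℕ} {l : List (Event n)} {v : V}
    (hl : AffordableList b l) (h : A.Decides input (A.execList input c l) (l.foldl recharge b) v) :
    A.Decides input c b v := by
  obtain ⟨l', hl', p, hp⟩ := h
  exact ⟨l ++ l', (affordableList_append _ _ _).mpr ⟨hl, hl'⟩, p, by rwa [execList_append]⟩

theorem execList_steps_loc_of_notMem (c : A.Config) {L : List (Fin n)} {q : Fin n} (hq : q ∉ L) :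
    (A.execList input c (L.map .step)).loc q = c.loc q := by
  induction L generalizing c with
  | nil => rfl
  | cons p L ih =>
    rw [List.mem_cons, not_or] at hq
    rw [List.map_cons, execList_cons, ih _ hq.2, exec_step_loc_of_ne A input c hq.1]

/-- The effect of steps of distinct processes that are all about to access the same object. -/
theorem execList_steps_shared {c : A.Config} {o : A.Obj} {op : Fin n → (A.kind o).Op}
    {k : Fin n → (A.kind o).Resp → A.Loc}
    (h : ∀ p, A.action p (c.loc p) = .invoke o (op p) (k p)) {L : List (Fin n)} (hL : L.Nodup) :
    (A.execList input c (L.map .step)).shared o = (A.kind o).run op (c.shared o) L ∧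
      ∀ o', o' ≠ o → (A.execList input c (L.map .step)).shared o' = c.shared o' := by
  induction L using List.reverseRecOn with
  | nil => simp
  | append_singleton L p ih =>
    rw [List.nodup_append] at hL
    obtain ⟨ih1, ih2⟩ := ih hL.1
    have hp : p ∉ L := fun hp => hL.2.2 p hp p (by simp) rfl
    have hact : A.action p ((A.execList input c (L.map .step)).loc p) = .invoke o (op p) (k p) := by
      rw [execList_steps_loc_of_notMem c hp, h]
    rw [List.map_append, execList_append]
    simp only [List.map_cons, List.map_nil, execList_cons, execList_nil]
    rw [exec_step_shared_self A input hact, ObjType.run_append, ih1]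
    exact ⟨rfl, fun o' ho => by rw [exec_step_shared_of_ne A input hact ho, ih2 o' ho]⟩

theorem execList_steps_shared_congr {c : A.Config} {o : A.Obj} {op : Fin n → (A.kind o).Op}
    {k : Fin n → (A.kind o).Resp → A.Loc}
    (h : ∀ p, A.action p (c.loc p) = .invoke o (op p) (k p)) {L L' : List (Fin n)} (hL : L.Nodup)
    (hL' : L'.Nodup)
    (hrun : (A.kind o).run op (c.shared o) L = (A.kind o).run op (c.shared o) L') :
    (A.execList input c (L.map .step)).shared = (A.execList input c (L'.map .step)).shared := by
  obtain ⟨h1, h2⟩ := execList_steps_shared (input := input) h hL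
  obtain ⟨h1', h2'⟩ := execList_steps_shared (input := input) h hL'
  funext o'
  by_cases ho : o' = o
  · subst ho; rw [h1, h1', hrun]
  · rw [h2 o' ho, h2' o' ho]

theorem exec_step_comm {c : A.Config} {p q : Fin n} (hpq : p ≠ q) {o o' : A.Obj} (ho : o ≠ o')
    {op : (A.kind o).Op} {k : (A.kind o).Resp → A.Loc} {op' : (A.kind o').Op}
    {k' : (A.kind o').Resp → A.Loc} (hp : A.action p (c.loc p) = .invoke o op k)
    (hq : A.action q (c.loc q) = .invoke o' op' k') :
    A.exec input (A.exec input c (.step p)) (.step q) =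
      A.exec input (A.exec input c (.step q)) (.step p) := by
  have hq' : A.action q ((A.exec input c (.step p)).loc q) = .invoke o' op' k' := by
    rw [exec_step_loc_of_ne A input c hpq.symm, hq]
  have hp' : A.action p ((A.exec input c (.step q)).loc p) = .invoke o op k := by
    rw [exec_step_loc_of_ne A input c hpq, hp]
  apply Config.ext'
  · intro r
    by_cases hrp : r = p
    · subst hrp
      rw [exec_step_loc_of_ne A input _ hpq, exec_step_loc_self A input hp,
        exec_step_loc_self A input hp', exec_step_shared_of_ne A input hq ho]
    by_cases hrq : r = q
    · subst hrq
      rw [exec_step_loc_self A input hq', exec_step_loc_of_ne A input _ hpq.symm,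
        exec_step_loc_self A input hq, exec_step_shared_of_ne A input hp ho.symm]
    · rw [exec_step_loc_of_ne A input _ hrq, exec_step_loc_of_ne A input _ hrp,
        exec_step_loc_of_ne A input _ hrp, exec_step_loc_of_ne A input _ hrq]
  · intro r
    by_cases hro : r = o
    · subst hro
      rw [exec_step_shared_of_ne A input hq' ho, exec_step_shared_self A input hp,
        exec_step_shared_self A input hp', exec_step_shared_of_ne A input hq ho]
    by_cases hro' : r = o'
    · subst hro'
      rw [exec_step_shared_self A input hq', exec_step_shared_of_ne A input hp ho.symm,
        exec_step_shared_of_ne A input hp' ho.symm, exec_step_shared_self A input hq]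
    · rw [exec_step_shared_of_ne A input hq' hro', exec_step_shared_of_ne A input hp hro,
        exec_step_shared_of_ne A input hp' hro, exec_step_shared_of_ne A input hq hro']

end

namespace SolvesRC

variable {A : Algorithm V 𝒯 n} (h : A.SolvesRC) {input : Fin n → V}
include h

/-- If a process cannot distinguish two reachable configurations, then some value can be decided
from both. -/
theorem exists_common_decision {l l' : List (Event n)} {p : Fin n}
    (hloc : (A.execList input (A.initial input) l).loc p =
      (A.execList input (A.initial input) l').loc p)
    (hsh : (A.execList input (A.initial input) l).shared =
      (A.execList input (A.initial input) l').shared) (b b' : Fin n → ℕ) :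
    ∃ v, A.Decides input (A.execList input (A.initial input) l) b v ∧
      A.Decides input (A.execList input (A.initial input) l') b' v := by
  obtain ⟨k, v, hv⟩ := h.solo_terminates input l p
  have haff : ∀ b : Fin n → ℕ, AffordableList b (List.replicate k (.step p)) := fun b => by
    simpa using affordableList_steps b (List.replicate k p)
  refine ⟨v, ⟨_, haff b, p, hv⟩, ⟨_, haff b', p, ?_⟩⟩
  rw [← (solo_congr A input input p k hloc hsh).1, hv]

theorem exists_decision (l : List (Event n)) (p : Fin n) (b : Fin n → ℕ) :
    ∃ v, A.Decides input (A.execList input (A.initial input) l) b v := by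
  obtain ⟨v, hv, -⟩ := h.exists_common_decision (l := l) (l' := l) (p := p) rfl rfl b b
  exact ⟨v, hv⟩

/-- Consequently no process has returned in a bivalent configuration. -/
theorem eq_of_output_of_decides {l : List (Event n)} {b : Fin n → ℕ} {p : Fin n} {v w : V}
    (hv : A.action p ((A.execList input (A.initial input) l).loc p) = .output v)
    (hw : A.Decides input (A.execList input (A.initial input) l) b w) : v = w := by
  obtain ⟨l', -, q, hq⟩ := hw
  rw [← execList_append] at hq
  exact h.agreement_list input hv hq

omit h in
/-- Two different values can be decided. -/
def _root_.Algorithm.Bivalent (A : Algorithm V 𝒯 n) (input : Fin n → V) (c : A.Config)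
    (b : Fin n → ℕ) : Prop :=
  ∃ v w, v ≠ w ∧ A.Decides input c b v ∧ A.Decides input c b w

/-- A process running alone cannot tell the inputs from those where everybody has its own input, and
validity fixes the output there. -/
theorem initial_bivalent [DecidableEq (Fin n)] {p q : Fin n} (hpq : p ≠ q) {v w : V} (hvw : v ≠ w)
    (b : Fin n → ℕ) :
    A.Bivalent (fun r => if r = p then v else w)
      (A.initial fun r => if r = p then v else w) b := by
  have key : ∀ (r : Fin n) (u : V), (if r = p then v else w) = u →
      A.Decides (fun r => if r = p then v else w)
        (A.initial fun r => if r = p then v else w) b u := by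
    intro r u hu
    obtain ⟨k, v', hv'⟩ := h.solo_terminates (fun _ => u) [] r
    have heq := h.validity_list (fun _ => u) (l := [] ++ List.replicate k (.step r)) (p := r)
      (v := v') (by rw [execList_append]; exact hv')
    obtain ⟨_, rfl⟩ := heq
    refine ⟨List.replicate k (.step r), by simpa using affordableList_steps b (List.replicate k r),
      r, ?_⟩
    refine (congrArg (A.action r) (solo_congr A _ (fun _ => v') r k ?_ ?_).1).trans hv'
    · simp only [initial, execList_nil, hu]
    · rfl
  exact ⟨v, w, hvw, key p v (by simp), key q w (by simp [hpq.symm])⟩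

/-- Some reachable bivalent configuration becomes univalent with any affordable event. -/
theorem exists_critical {l₀ : List (Event n)} {b₀ : Fin n → ℕ}
    (h₀ : A.Bivalent input (A.execList input (A.initial input) l₀) b₀) :
    ∃ l b, A.Bivalent input (A.execList input (A.initial input) l) b ∧
      ∀ e, Affordable b e →
        ¬ A.Bivalent input (A.execList input (A.initial input) (l ++ [e])) (recharge b e) := by
  by_contra! hcon
  -- Without a critical configuration, bivalence can be preserved forever by affordable events; the
  -- fair process of that execution then outputs in a bivalent configuration.
  choose e haff hbiv using fun x : {x : List (Event n) × (Fin n → ℕ) //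
    A.Bivalent input (A.execList input (A.initial input) x.1) x.2} => hcon x.1.1 x.1.2 x.2
  let seq : ℕ → {x : List (Event n) × (Fin n → ℕ) //
      A.Bivalent input (A.execList input (A.initial input) x.1) x.2} := fun t =>
    Nat.rec ⟨(l₀, b₀), h₀⟩ (fun _ x => ⟨(x.1.1 ++ [e x], recharge x.1.2 (e x)), hbiv x⟩) t
  obtain ⟨p, t₀, hcrash, hinf⟩ := exists_fair_process (fun t => e (seq t)) (fun t => (seq t).1.2)
    (fun _ => rfl) (fun t => haff (seq t))
  have hseq : ∀ t, (seq t).1.1 = l₀ ++ (List.range t).map fun t => e (seq t) := by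
    intro t
    induction t with
    | zero => simp [seq]
    | succ t ih =>
      rw [List.range_succ, List.map_append, ← List.append_assoc, ← ih]
      rfl
  let σ : ℕ → Event n := fun t => if t < l₀.length then l₀.getD t (.step p)
    else e (seq (t - l₀.length))
  have hσ : ∀ t, σ (l₀.length + t) = e (seq t) := fun t => by simp [σ]
  have hconf : ∀ t, A.config input σ (l₀.length + t) =
      A.execList input (A.initial input) (seq t).1.1 := by
    intro t
    rw [config_eq_execList, hseq, List.range_add, List.map_append]
    congr 2
    · apply List.ext_getElem
      · simp
      · intro i h1 h2
        simp [σ, h2]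
    · rw [List.map_map]
      exact List.map_congr_left fun t _ => hσ t
  obtain ⟨t, v, ht, hv⟩ := h.waitFree input σ p (l₀.length + t₀) (by
      intro t ht
      obtain ⟨j, rfl⟩ := Nat.exists_eq_add_of_le ht
      rw [add_assoc, hσ]
      exact hcrash _ (by omega))
    ((hinf.image (Set.injOn_of_injective (add_right_injective l₀.length))).mono (by
      rintro _ ⟨t, ht, rfl⟩
      exact (hσ t).trans ht))
  obtain ⟨j, rfl⟩ := Nat.exists_eq_add_of_le ht
  rw [Outputs, add_assoc, hconf] at hv
  obtain ⟨u, w, huw, hu, hw⟩ := (seq (t₀ + j)).2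
  exact huw ((h.eq_of_output_of_decides hv hu).symm.trans (h.eq_of_output_of_decides hv hw))

/-- If at least three processes can solve recoverable consensus, then one of the objects has a
type that is recording for one process fewer. -/
theorem exists_isRecording [Nontrivial V] (hn : 3 ≤ n) :
    ∃ (o : A.Obj) (q : (A.kind o).State) (x : Fin n) (team : {i // i ≠ x} → Bool)
      (op : {i // i ≠ x} → (A.kind o).Op), (A.kind o).IsRecording q team op := by
  classical
  obtain ⟨v₀, w₀, hvw⟩ := exists_pair_ne V
  let p₀ : Fin n := ⟨0, by omega⟩
  let p₁ : Fin n := ⟨1, by omega⟩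
  have hp : p₀ ≠ p₁ := by simp [p₀, p₁]
  obtain ⟨l, b, ⟨v, w, hne, hv, hw⟩, huni⟩ :=
    -- Zero initial budgets suffice, since the crash used at the critical configuration is paid for
    -- by the steps just before it.
    h.exists_critical (l₀ := []) (h.initial_bivalent hp hvw fun _ => 0)
  generalize (fun r => if r = p₀ then v₀ else w₀) = input at *
  set c := A.execList input (A.initial input) l with hc
  -- the value decided after a step of a process
  have hstep : ∀ L : List (Fin n), A.execList input c (L.map .step) =
      A.execList input (A.initial input) (l ++ L.map .step) := fun L => by rw [execList_append]
  have hval : ∀ p, ∃ v, A.Decides input (A.execList input (A.initial input) (l ++ [.step p]))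
      (recharge b (.step p)) v := fun p => h.exists_decision _ p _
  choose val hval using hval
  have huniq : ∀ p u, A.Decides input (A.execList input (A.initial input) (l ++ [.step p]))
      (recharge b (.step p)) u → u = val p := by
    intro p u hu
    by_contra hne
    exact huni (.step p) trivial ⟨_, _, hne, hu, hval p⟩
  -- values decided later
  have hlater : ∀ p (l' : List (Event n)) u, AffordableList (recharge b (.step p)) l' →
      A.Decides input (A.execList input (A.initial input) (l ++ .step p :: l'))
        (l'.foldl recharge (recharge b (.step p))) u → u = val p := by
    intro p l' u hl' hu
    refine huniq p u (Decides.of_execList hl' ?_)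
    rwa [← execList_append, List.append_assoc, List.singleton_append]
  have hnoout : ∀ p u, A.action p (c.loc p) ≠ .output u := fun p u hu =>
    hne ((h.eq_of_output_of_decides hu hv).symm.trans (h.eq_of_output_of_decides hu hw))
  -- If all steps led to the same value, bivalence would have to come from a crash. But some process
  -- does not notice that crash and leads to the common value after it, so the crash would preserve
  -- bivalence.
  have hsplit : ∃ i j, val i ≠ val j := by
    by_contra! hall
    have hkey : ∀ u, A.Decides input c b u → u = val p₀ := by
      rintro u ⟨_ | ⟨e, l'⟩, hl', p, hp'⟩
      · exact absurd hp' (hnoout p u)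
      have hdec : A.Decides input (A.execList input (A.initial input) (l ++ [e]))
          (recharge b e) u := ⟨l', hl'.2, p, by rw [execList_append]; exact hp'⟩
      cases e with
      | step q => rw [huniq q u hdec, hall q p₀]
      | crash q =>
        -- `p₀` or, if that is the process that crashes, `p₁` does not notice the crash
        obtain ⟨r, hr⟩ : ∃ r, r ≠ q := by
          by_cases hq : p₀ = q
          · exact ⟨p₁, fun h' => hp (hq.trans h'.symm)⟩
          · exact ⟨p₀, hq⟩
        have hsame := solo_congr A input input r 1 (exec_crash_loc_of_ne A input c hr)
          (exec_crash_shared A input c q)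
        obtain ⟨u', hu', hu''⟩ := h.exists_common_decision (input := input)
          (l := l ++ [.crash q] ++ [.step r]) (l' := l ++ [.step r]) (p := r)
          (by simp only [execList_append]; exact hsame.1)
          (by simp only [execList_append]; exact hsame.2)
          (recharge (recharge b (.crash q)) (.step r)) (recharge b (.step r))
        have h1 := huniq r u' hu''
        by_contra hu
        refine huni (.crash q) hl'.1 ⟨u, u', ?_, hdec, ?_⟩
        · rwa [h1, hall r p₀]
        · rw [execList_append] at hu'
          exact Decides.of_execList (l := [.step r]) ⟨trivial, trivial⟩ hu'
    exact hne ((hkey v hv).trans (hkey w hw).symm)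
  have hinv : ∀ p, ∃ (o : A.Obj) (op : (A.kind o).Op) (k : (A.kind o).Resp → A.Loc),
      A.action p (c.loc p) = .invoke o op k := by
    intro p
    cases hact : A.action p (c.loc p) with
    | output u => exact absurd hact (hnoout p u)
    | invoke o op k => exact ⟨o, op, k, rfl⟩
  choose ob hinv using hinv
  -- Steps on different objects commute, so both orders reach one configuration, whose decision
  -- would equal both values.
  have hcomm : ∀ i j, val i ≠ val j → ob i = ob j := by
    intro i j hij
    by_contra ho
    obtain ⟨op, k, hi⟩ := hinv i
    obtain ⟨op', k', hj⟩ := hinv j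
    have hcc := exec_step_comm (input := input) (fun h' => hij (congrArg val h')) ho hi hj
    have hcc' : A.execList input (A.initial input) (l ++ [.step i, .step j]) =
        A.execList input (A.initial input) (l ++ [.step j, .step i]) := by
      rw [execList_append, execList_append]; exact hcc
    obtain ⟨u, hu, hu'⟩ := h.exists_common_decision (p := i) (congrArg (fun c => c.loc i) hcc')
      (congrArg Config.shared hcc') (recharge (recharge b (.step i)) (.step j))
      (recharge (recharge b (.step j)) (.step i))
    exact hij ((hlater i [.step j] u ⟨trivial, trivial⟩ hu).symm.trans
      (hlater j [.step i] u ⟨trivial, trivial⟩ hu'))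
  obtain ⟨o, ho⟩ : ∃ o, ∀ p, ob p = o := by
    obtain ⟨i, j, hij⟩ := hsplit
    refine ⟨ob i, fun p => ?_⟩
    by_cases hpi : val p = val i
    · rw [hcomm p j (hpi ▸ hij), hcomm i j hij]
    · exact hcomm p i hpi
  have hinv' : ∀ p, ∃ (op : (A.kind o).Op) (k : (A.kind o).Resp → A.Loc),
      A.action p (c.loc p) = .invoke o op k := by
    intro p
    obtain rfl := ho p
    exact hinv p
  choose op k hact using hinv'
  have hshared : ∀ {L : List (Fin n)}, L.Nodup → (A.kind o).run op (c.shared o) L = c.shared o →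
      (A.execList input c (L.map .step)).shared = c.shared := fun hL hrun =>
    execList_steps_shared_congr (input := input) (L' := []) hact hL List.nodup_nil hrun
  obtain ⟨x, team, hrec⟩ := ObjType.exists_isRecording_of_forall hn (c.shared o) op val hsplit
    (by
      -- The idle process `y` sees the same memory and its own unchanged local state after both
      -- orders.
      intro y i L i' L' hL hL' hy hy' hrun
      obtain ⟨u, hu, hu'⟩ := h.exists_common_decision (input := input) (p := y)
        (l := l ++ (i :: L).map .step) (l' := l ++ (i' :: L').map .step)
        (by rw [← hstep, ← hstep, execList_steps_loc_of_notMem c hy,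
              execList_steps_loc_of_notMem c hy'])
        (by rw [← hstep, ← hstep]; exact execList_steps_shared_congr hact hL hL' hrun)
        (((i :: L).map .step).foldl recharge b) (((i' :: L').map .step).foldl recharge b)
      exact (hlater i _ u (affordableList_steps _ L) hu).symm.trans
        (hlater i' _ u (affordableList_steps _ L') hu'))
    (by
      -- For `y`, stepping after the restoring order is the same as stepping at once from `c`.
      intro y i L hL hy hrun
      have hsame := solo_congr A input input y 1
        (execList_steps_loc_of_notMem (input := input) c hy) (hshared hL hrun)
      obtain ⟨u, hu, hu'⟩ := h.exists_common_decision (input := input) (p := y)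
        (l := l ++ ((i :: L).map .step ++ [.step y])) (l' := l ++ [.step y])
        (by simp only [execList_append]; exact hsame.1)
        (by simp only [execList_append]; exact hsame.2)
        (((i :: L).map Event.step ++ [Event.step y]).foldl recharge b) (recharge b (.step y))
      refine (hlater i (L.map Event.step ++ [Event.step y]) u ?_ hu).symm.trans (huniq y u hu')
      simpa using affordableList_steps (recharge b (.step i)) (L ++ [y]))
    (by
      -- The step of `a < z` funds a crash of `z`, which erases all that `z` has seen; it restarts
      -- with the same memory in both executions.
      intro z a i L i' L' hL hL' haz _ _ ha ha' hrun hrun'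
      have haff : ∀ {i L}, a ∈ i :: L →
          AffordableList (recharge b (.step i)) (L.map .step ++ [.crash z]) := by
        intro i L ha
        refine (affordableList_append _ _ _).mpr ⟨affordableList_steps _ _, ?_, trivial⟩
        exact foldl_recharge_steps_pos b ha haz
      have hloc : ∀ L : List (Fin n), (A.execList input (A.initial input)
          (l ++ (L.map .step ++ [.crash z]))).loc z = A.initLocal z (input z) := fun L => by
        rw [execList_append, execList_append]; exact exec_crash_loc_self A input _ z
      have hsh : ∀ {L : List (Fin n)}, L.Nodup →
          (A.kind o).run op (c.shared o) L = c.shared o → (A.execList input (A.initial input)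
            (l ++ (L.map .step ++ [.crash z]))).shared = c.shared := fun hL hrun => by
        rw [execList_append, execList_append]
        exact (exec_crash_shared A input _ z).trans (hshared hL hrun)
      obtain ⟨u, hu, hu'⟩ := h.exists_common_decision (input := input) (p := z)
        ((hloc (i :: L)).trans (hloc (i' :: L')).symm)
        ((hsh hL hrun).trans (hsh hL' hrun').symm)
        (((i :: L).map Event.step ++ [Event.crash z]).foldl recharge b)
        (((i' :: L').map Event.step ++ [Event.crash z]).foldl recharge b)
      exact (hlater i _ u (haff ha) hu).symm.trans (hlater i' _ u (haff ha') hu'))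
  exact ⟨o, _, x, team, _, hrec⟩

end SolvesRC

end Algorithm

/-! ### One match between two teams -/

/-- The phases of the program that a process executes to take part in a match. -/
inductive Phase : Type
  | write
  | look
  | check
  | apply
  | relook
  | fetch (X : Bool)

namespace ObjType

section Match

variable {V : Type u} {ι : Type*} (T : ObjType.{u}) (q₀ : T.State) (team : ι → Bool) (op : ι → T.Op)

/-- The invariant of the objects of a match. `iv` gives the values proposed by the teams, `q` is the
state of the recording object, `L` lists the roles that have accessed this object since it was in
its initial state, `d` is the decision (the winning team and its value) and `reg` are the contents
of the registers of the teams. -/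
structure MatchInv (iv : Bool → Option V) (q : T.State) (L : List ι) (d : Option (Bool × V))
    (reg : Bool → Option V) : Prop where
  nodup : L.Nodup
  state : q = T.run op q₀ L
  head : ∀ i l, L = i :: l → ∃ u, d = some (team i, u)
  proposed : ∀ X u, d = some (X, u) → iv X = some u
  written : ∀ X u, d = some (X, u) → reg X = some u
  dec_nil : ∀ X u, d = some (X, u) → L = [] → X = true ∧ q₀ ∈ T.FirstBy op team q₀ true
  reg : ∀ X u, reg X = some u → iv X = some u

/-- The invariant of a process that plays the role `i` in a match and proposes `v`. -/
def PhaseInv (L : List ι) (d : Option (Bool × V)) (reg : Bool → Option V) (i : ι) (v : V) :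
    Phase → Prop
  | .write => True
  | .look => reg (team i) = some v
  | .check => reg (team i) = some v ∧ i ∉ L ∧ q₀ ∈ T.FirstBy op team q₀ true ∧ team i = false ∧
      ∀ u, d ≠ some (false, u)
  | .apply => reg (team i) = some v ∧ i ∉ L ∧ ∀ u, d = some (true, u) → L = [] → team i = true
  | .relook => ∃ x, d = some x
  | .fetch X => ∃ u, d = some (X, u)

variable {T q₀ team op} {iv : Bool → Option V} {q : T.State} {L : List ι} {d : Option (Bool × V)}
  {reg : Bool → Option V}

theorem MatchInv.mono (h : T.MatchInv q₀ team op iv q L d reg) {iv' : Bool → Option V}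
    (hiv : ∀ X u, iv X = some u → iv' X = some u) : T.MatchInv q₀ team op iv' q L d reg where
  nodup := h.nodup
  state := h.state
  head := h.head
  proposed X u hd := hiv X u (h.proposed X u hd)
  written := h.written
  dec_nil := h.dec_nil
  reg X u hr := hiv X u (h.reg X u hr)

/-- All members of a team write the same value, so a late or repeated write never changes a register
that was already written. -/
theorem MatchInv.write (h : T.MatchInv q₀ team op iv q L d reg) {X : Bool} {v : V}
    (hv : iv X = some v) : T.MatchInv q₀ team op iv q L d (Function.update reg X (some v)) where
  nodup := h.nodup
  state := h.state
  head := h.head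
  proposed := h.proposed
  written Y u hd := by
    by_cases hY : Y = X
    · subst hY
      rw [Function.update_self, ← hv, h.proposed _ _ hd]
    · rw [Function.update_of_ne hY, h.written _ _ hd]
  dec_nil := h.dec_nil
  reg Y u hr := by
    by_cases hY : Y = X
    · subst hY
      rwa [Function.update_self, ← hv] at hr
    · rw [Function.update_of_ne hY] at hr
      exact h.reg _ _ hr

theorem PhaseInv.write {X : Bool} {v w : V} {j : ι} {f : Phase} (hv : iv X = some v)
    (hw : iv (team j) = some w) (h : T.PhaseInv q₀ team op L d reg j w f) :
    T.PhaseInv q₀ team op L d (Function.update reg X (some v)) j w f := by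
  have hreg : reg (team j) = some w → Function.update reg X (some v) (team j) = some w := by
    intro hr
    by_cases hY : team j = X
    · rw [hY, Function.update_self, ← hv, ← hY, hw]
    · rw [Function.update_of_ne hY, hr]
  cases f with
  | write => trivial
  | look => exact hreg h
  | check => exact ⟨hreg h.1, h.2⟩
  | apply => exact ⟨hreg h.1, h.2⟩
  | relook => exact h
  | fetch X => exact h

theorem MatchInv.mem_firstBy_head (h : T.MatchInv q₀ team op iv q L d reg) (hL : L ≠ []) :
    ∃ X u, d = some (X, u) ∧ q ∈ T.FirstBy op team q₀ X := by
  obtain ⟨i, l, rfl⟩ := List.exists_cons_of_ne_nil hL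
  obtain ⟨u, hu⟩ := h.head i l rfl
  exact ⟨_, u, hu, i, l, rfl, h.nodup, h.state.symm⟩

/-- A list of roles that starts with team `true` and restores the initial state contains all roles
of team `false`. -/
theorem IsRecording.mem_of_run_eq (hT : T.IsRecording q₀ team op) {i j : ι} {l : List ι}
    (hi : team i = true) (hj : team j = false) (hl : (i :: l).Nodup)
    (hrun : T.run op q₀ (i :: l) = q₀) : j ∈ i :: l := by
  by_contra hmem
  refine hT.disjoint (T.next q₀ (op j)) ⟨i, l ++ [j], hi, ?_, ?_⟩ ⟨j, [], hj, by simp, rfl⟩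
  · rw [← List.cons_append, List.nodup_append]
    refine ⟨hl, by simp, ?_⟩
    rintro a ha b hb rfl
    rw [List.mem_singleton] at hb
    exact hmem (hb ▸ ha)
  · rw [← List.cons_append, run_append, hrun]; rfl

/-- When the object is back in its initial state, the history `L` can be forgotten while the
decision is kept: by `fresh`, that decision must favour team `true`. -/
theorem MatchInv.reset (hT : T.IsRecording q₀ team op) (h : T.MatchInv q₀ team op iv q L d reg)
    (hq : q = q₀) : T.MatchInv q₀ team op iv q [] d reg where
  nodup := List.nodup_nil
  state := hq
  head := by simp
  proposed := h.proposed
  written := h.written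
  dec_nil X u hd _ := by
    by_cases hL : L = []
    · exact h.dec_nil X u hd hL
    obtain ⟨Y, w, hY, hmem⟩ := h.mem_firstBy_head hL
    rw [hd, Option.some.injEq, Prod.mk.injEq] at hY
    obtain ⟨rfl, rfl⟩ := hY
    subst hq
    cases X with
    | false => exact absurd hmem hT.fresh
    | true => exact ⟨rfl, hmem⟩
  reg := h.reg

/-- The critical case is a pending operation of team `false`, which could overturn the recorded
winner. There is none: restoring the state after a start by team `true` uses up every role of team
`false`, whereas a pending role is absent from `L`. -/
theorem PhaseInv.reset (hT : T.IsRecording q₀ team op) (h : T.MatchInv q₀ team op iv q L d reg)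
    (hq : q = q₀) {j : ι} {w : V} {f : Phase} (hf : T.PhaseInv q₀ team op L d reg j w f) :
    T.PhaseInv q₀ team op [] d reg j w f := by
  cases f with
  | write => trivial
  | look => exact hf
  | check => exact ⟨hf.1, by simp, hf.2.2⟩
  | apply =>
    refine ⟨hf.1, by simp, fun u hd _ => ?_⟩
    by_contra hj
    rw [Bool.not_eq_true] at hj
    cases L with
    | nil => rw [hf.2.2 u hd rfl] at hj; simp at hj
    | cons i l =>
      obtain ⟨u', hu'⟩ := h.head i l rfl
      rw [hd, Option.some.injEq, Prod.mk.injEq] at hu'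
      exact hf.2.1 (hT.mem_of_run_eq hu'.1.symm hj h.nodup (h.state.symm.trans hq))
  | relook => exact hf
  | fetch X => exact hf

open Classical in
/-- A process that sees that the match has begun knows the winning team. -/
theorem MatchInv.decided (hT : T.IsRecording q₀ team op) (h : T.MatchInv q₀ team op iv q L d reg)
    (hd : q ≠ q₀ ∨ ∃ x, d = some x) :
    ∃ u, d = some (decide (q ∈ T.FirstBy op team q₀ true), u) := by
  by_cases hL : L = []
  · have hq : q = q₀ := by rw [h.state, hL]; rfl
    obtain ⟨⟨X, u⟩, hx⟩ := hd.resolve_left (not_not.mpr hq)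
    obtain ⟨rfl, hmem⟩ := h.dec_nil X u hx hL
    exact ⟨u, by simpa [hq, hmem] using hx⟩
  · obtain ⟨X, u, hx, hmem⟩ := h.mem_firstBy_head hL
    refine ⟨u, ?_⟩
    cases X with
    | true => simpa [hmem] using hx
    | false =>
      have : q ∉ T.FirstBy op team q₀ true := fun h' => hT.disjoint q h' hmem
      simpa [this] using hx

/-- The phase after seeing the initial state. -/
theorem MatchInv.phaseInv_apply (hT : T.IsRecording q₀ team op)
    (h : T.MatchInv q₀ team op iv q L d reg) (hq : q = q₀) {i : ι} {v : V}
    (hv : reg (team i) = some v)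
    (hi : ¬ (q₀ ∈ T.FirstBy op team q₀ true ∧ team i = false)) :
    T.PhaseInv q₀ team op [] d reg i v .apply := by
  refine ⟨hv, by simp, fun u hd _ => ?_⟩
  have := ((h.reset hT hq).dec_nil _ _ hd rfl).2
  by_contra hj
  exact hi ⟨this, by simpa using hj⟩

theorem MatchInv.phaseInv_check (hT : T.IsRecording q₀ team op)
    (h : T.MatchInv q₀ team op iv q L d reg) (hq : q = q₀) {i : ι} {v : V}
    (hv : reg (team i) = some v)
    (hi : q₀ ∈ T.FirstBy op team q₀ true ∧ team i = false) :
    T.PhaseInv q₀ team op [] d reg i v .check :=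
  ⟨hv, by simp, hi.1, hi.2, fun u hd => by
    simpa using ((h.reset hT hq).dec_nil _ _ hd rfl).1⟩

/-- A decision for team `true` requires its register to be written, so an empty register rules that
decision out. -/
theorem MatchInv.phaseInv_apply_of_check (h : T.MatchInv q₀ team op iv q L d reg) {i : ι} {v : V}
    (hreg : reg true = none) (hi : T.PhaseInv q₀ team op L d reg i v .check) :
    T.PhaseInv q₀ team op L d reg i v .apply :=
  ⟨hi.1, hi.2.1, fun u hd => by simpa [hreg] using h.written _ _ hd⟩

/-- Giving up may itself be what decides the match for team `true`, before the object is accessed.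
This is harmless because the role that gives up is the only member of team `false`, so every other
pending operation belongs to team `true`. -/
theorem MatchInv.check (hT : T.IsRecording q₀ team op)
    (h : T.MatchInv q₀ team op iv q L d reg) {i : ι} {v u : V}
    (hreg : reg true = some u) (hi : T.PhaseInv q₀ team op L d reg i v .check) :
    (∀ x, d = some x → some (true, u) = some x) ∧
      T.MatchInv q₀ team op iv q L (some (true, u)) reg ∧
      ∀ j w f, j ≠ i → T.PhaseInv q₀ team op L d reg j w f →
        T.PhaseInv q₀ team op L (some (true, u)) reg j w f := by
  obtain ⟨-, -, hq₀, hfalse, hd⟩ := hi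
  have hle : ∀ x, d = some x → some (true, u) = some x := by
    rintro ⟨_ | _, w⟩ hx
    · exact absurd hx (hd w)
    · have := h.written _ _ hx
      rw [hreg, Option.some.injEq] at this
      rw [this]
  refine ⟨hle, ⟨h.nodup, h.state, ?_, ?_, ?_, ?_, h.reg⟩, ?_⟩
  · intro j l hl
    obtain ⟨w, hw⟩ := h.head j l hl
    exact ⟨w, hle _ hw⟩
  · rintro X w ⟨⟩
    exact h.reg _ _ hreg
  · rintro X w ⟨⟩
    exact hreg
  · rintro X w ⟨⟩ _
    exact ⟨rfl, hq₀⟩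
  · intro j w f hj hf
    cases f with
    | write => trivial
    | look => exact hf
    | check => exact ⟨hf.1, hf.2.1, hf.2.2.1, hf.2.2.2.1, by simp⟩
    | apply =>
      refine ⟨hf.1, hf.2.1, fun _ _ _ => ?_⟩
      by_contra hj'
      exact hj (hT.single hq₀ j i (by simpa using hj') hfalse)
    | relook => exact ⟨_, rfl⟩
    | fetch X =>
      obtain ⟨w, hw⟩ := hf
      exact ⟨w, hle _ hw⟩

/-- An existing decision stays; otherwise the role that acts wins for its team. If the history is
empty but the match is decided, the invariant of the phase guarantees that the new first role is in
team `true`, the recorded winner. -/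
theorem MatchInv.apply (hT : T.IsRecording q₀ team op)
    (h : T.MatchInv q₀ team op iv q L d reg) {i : ι} {v : V}
    (hi : T.PhaseInv q₀ team op L d reg i v .apply) :
    ∃ d' : Option (Bool × V), (∀ x, d = some x → d' = some x) ∧ (∃ x, d' = some x) ∧
      T.MatchInv q₀ team op iv (T.next q (op i)) (L ++ [i]) d' reg ∧
      ∀ j w f, j ≠ i → T.PhaseInv q₀ team op L d reg j w f →
        T.PhaseInv q₀ team op (L ++ [i]) d' reg j w f := by
  obtain ⟨hreg, hiL, hlate⟩ := hi
  let d' := d.orElse fun _ => some (team i, v)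
  have hle : ∀ x, d = some x → d' = some x := by
    rintro x rfl; rfl
  have hnew : ∀ x, d' = some x → d = some x ∨ d = none ∧ x = (team i, v) := by
    intro x hx
    cases hd : d with
    | none => simp only [d', hd] at hx; right; simpa [eq_comm] using hx
    | some y => rw [hle y hd] at hx; left; exact hx
  have hsome : ∃ x, d' = some x := by
    cases hd : d with
    | none => exact ⟨(team i, v), by simp [d', hd]⟩
    | some y => exact ⟨y, hle y hd⟩
  refine ⟨d', hle, hsome, ⟨?_, ?_, ?_, ?_, ?_, ?_, h.reg⟩, ?_⟩
  · rw [List.nodup_append]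
    refine ⟨h.nodup, by simp, ?_⟩
    rintro a ha b hb rfl
    rw [List.mem_singleton] at hb
    exact hiL (hb ▸ ha)
  · rw [run_append, h.state]; rfl
  · intro j l hl
    cases L with
    | cons k L =>
      simp only [List.cons_append, List.cons.injEq] at hl
      obtain ⟨w, hw⟩ := h.head k L rfl
      exact ⟨w, by rw [← hl.1]; exact hle _ hw⟩
    | nil =>
      simp only [List.nil_append, List.cons.injEq] at hl
      obtain ⟨⟨X, w⟩, hx⟩ := hsome
      rcases hnew _ hx with hd | ⟨-, hd⟩
      · obtain ⟨rfl, -⟩ := h.dec_nil _ _ hd rfl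
        exact ⟨w, by rw [hx, ← hl.1, hlate w hd rfl]⟩
      · simp only [Prod.mk.injEq] at hd
        exact ⟨w, by rw [hx, ← hl.1, hd.1]⟩
  · intro X w hx
    rcases hnew _ hx with hd | ⟨-, hd⟩
    · exact h.proposed _ _ hd
    · obtain ⟨rfl, rfl⟩ := Prod.mk.inj hd
      exact h.reg _ _ hreg
  · intro X w hx
    rcases hnew _ hx with hd | ⟨-, hd⟩
    · exact h.written _ _ hd
    · obtain ⟨rfl, rfl⟩ := Prod.mk.inj hd
      exact hreg
  · simp
  · intro j w f hj hf
    have hjL : j ∉ L → j ∉ L ++ [i] := by simp [hj]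
    cases f with
    | write => trivial
    | look => exact hf
    | check =>
      refine ⟨hf.1, hjL hf.2.1, hf.2.2.1, hf.2.2.2.1, fun u hu => ?_⟩
      rcases hnew _ hu with hd | ⟨-, hd⟩
      · exact hf.2.2.2.2 u hd
      -- A role in the check phase is the only member of team `false`, so a different role cannot
      -- decide for that team.
      · exact hj (hT.single hf.2.2.1 j i hf.2.2.2.1 (Prod.mk.inj hd).1.symm)
    | apply => exact ⟨hf.1, hjL hf.2.1, by simp⟩
    | relook => exact hsome
    | fetch X =>
      obtain ⟨w, hw⟩ := hf
      exact ⟨w, hle _ hw⟩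

end Match

end ObjType

/-! ### Brackets -/

/-- A bracket schedules matches, which are numbered. In each match, several processes play against
each other, with different roles, and all processes of one team come from the same previous
match, unless the team is a single process that plays its first match. -/
structure MatchBracket (n : ℕ) (team : Fin n → Bool) where
  /-- The first match of a process. -/
  entry : Fin n → ℕ
  /-- The match that follows a match. -/
  next : ℕ → Option ℕ
  /-- The processes that take part in a match. -/
  Mem : ℕ → Fin n → Prop
  /-- The role of a process in a match. -/
  role : ℕ → Fin n → Fin n
  /-- Where the value of a team in a match comes from: a match or the input of a process. -/
  src : ℕ → Bool → ℕ ⊕ Fin n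
  /-- An upper bound on the number of matches that follow. -/
  height : ℕ → ℕ
  mem_entry : ∀ p, Mem (entry p) p
  mem_next : ∀ {s s' p}, Mem s p → next s = some s' → Mem s' p
  role_inj : ∀ {s p q}, Mem s p → Mem s q → role s p = role s q → p = q
  src_entry : ∀ p, src (entry p) (team (role (entry p) p)) = .inr p
  src_next : ∀ {s s' p}, Mem s p → next s = some s' → src s' (team (role s' p)) = .inl s
  final : ∀ {s s'}, next s = none → next s' = none → s = s'
  height_lt : ∀ {s s'}, next s = some s' → height s' < height s

/-- If the first `a` processes form one team and the others another one, then each team can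
determine a value one process after the other, before the two teams play against each other in
match `0`. In match `s > 0`, process `s` joins the preceding members of its team, playing in the
role of a member of the other team. -/
def MatchBracket.ofThreshold {n a : ℕ} (ha : 0 < a) (han : a < n) :
    MatchBracket n (fun i => decide (i.1 < a)) where
  -- The first process of a block has nobody to join: it enters the match of its successor, or the
  -- final if it is alone in its block.
  entry p := if p.1 = 0 ∨ p.1 = a then (if p.1 + 1 = a ∨ n ≤ p.1 + 1 then 0 else p.1 + 1) else p.1
  next s := if s = 0 then none else if s + 1 = a ∨ n ≤ s + 1 then some 0 else some (s + 1)
  Mem s p := s = 0 ∨ (s < n ∧ s ≠ a ∧ p.1 ≤ s ∧ (s < a ∨ a ≤ p.1))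
  -- Any role of the opposite team would do for the newcomer; no one else in the match holds it,
  -- since the participants come from one block.
  role s p := if s ≠ 0 ∧ p.1 = s then (if s < a then ⟨a, han⟩ else ⟨0, by omega⟩) else p
  src s X :=
    -- The common value of the processes of a block up to `m`: the input of `m` if `m` starts the
    -- block, otherwise the outcome of match `m`.
    let block (m : ℕ) : ℕ ⊕ Fin n := if h : m < n ∧ (m = 0 ∨ m = a) then .inr ⟨m, h.1⟩ else .inl m
    if s = 0 then block (if X then a - 1 else n - 1)
    else if X = decide (s < a) then block (s - 1)
    -- Numbers from `n` on belong to no match, so the last value is arbitrary.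
    else if h : s < n then .inr ⟨s, h⟩ else .inl 0
  height s := if s = 0 then 0 else n - s + 1
  mem_entry p := by
    have := p.2
    split_ifs <;> omega
  mem_next := by
    intro s s' p hm hn
    have := p.2
    split_ifs at hn <;> simp only [Option.some.injEq] at hn <;> omega
  role_inj := by
    intro s p q hp hq h
    have := p.2
    have := q.2
    ext
    split_ifs at h <;> simp only [Fin.ext_iff] at h <;> omega
  src_entry := by
    rintro ⟨p, hp⟩
    have hblock : ∀ m, m = p → (p = 0 ∨ p = a) →
        (if h : m < n ∧ (m = 0 ∨ m = a) then Sum.inr ⟨m, h.1⟩ else Sum.inl m : ℕ ⊕ Fin n) =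
          .inr ⟨p, hp⟩ := by
      rintro m rfl h; rw [dif_pos ⟨hp, h⟩]
    by_cases h0 : p = 0 ∨ p = a
    · by_cases h1 : p + 1 = a ∨ n ≤ p + 1
      · simp only [h0, h1, if_true, ne_eq, not_true_eq_false, false_and, if_false]
        exact hblock _ (by simp only [decide_eq_true_eq]; split_ifs <;> omega) h0
      · have h2 : ¬ (p = p + 1) := by omega
        have h3 : p < a ↔ p + 1 < a := by omega
        simp only [h0, h1, h2, h3, if_true, if_false, and_false, Nat.succ_ne_zero]
        exact hblock _ (by omega) h0
    · have h1 : p ≠ 0 := by omega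
      have h2 : decide (((if p < a then ⟨a, han⟩ else ⟨0, by omega⟩ : Fin n) : ℕ) < a) ≠
          decide (p < a) := by
        split_ifs with h <;> simp [h, ha]
      simp only [if_neg h0]
      simp only [h1, h2, hp, if_true, if_false, ne_eq, not_false_eq_true, and_self, dif_pos]
  src_next := by
    rintro s s' ⟨p, hp⟩ hm hn
    have hblock : ∀ m, m = s → s ≠ 0 → s ≠ a →
        (if h : m < n ∧ (m = 0 ∨ m = a) then Sum.inr ⟨m, h.1⟩ else Sum.inl m : ℕ ⊕ Fin n) =
          .inl s := by
      rintro m rfl h h'; rw [dif_neg (by omega)]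
    by_cases h0 : s = 0
    · simp [h0] at hn
    simp only [h0, if_false, false_or] at hm hn
    by_cases h1 : s + 1 = a ∨ n ≤ s + 1
    · simp only [h1, if_true, Option.some.injEq] at hn
      subst hn
      simp only [ne_eq, not_true_eq_false, false_and, if_true, if_false, decide_eq_true_eq]
      exact hblock _ (by split_ifs <;> omega) h0 hm.2.1
    · simp only [h1, if_false, Option.some.injEq] at hn
      subst hn
      have h2 : ¬ (p = s + 1) := by omega
      have h3 : p < a ↔ s + 1 < a := by omega
      simp only [h2, h3, if_true, if_false, and_false, Nat.succ_ne_zero]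
      exact hblock _ (by omega) h0 hm.2.1
  final := by
    intro s s' h h'
    split_ifs at h h'
    omega
  height_lt := by
    intro s s' h
    split_ifs at h <;> simp only [Option.some.injEq] at h <;> split_ifs <;> omega

/-! ### The tournament algorithm -/

namespace Tournament

open ObjType

/-- The shared objects of a tournament: each match uses a recording object and a register for each
team. -/
inductive Cell : Type u
  | obj (s : ℕ)
  | reg (s : ℕ) (X : Bool)

/-- The local state of a process: it participates in a match with a value that it proposes, or it
has returned a value. -/
inductive Loc (V : Type u) : Type u
  | running (s : ℕ) (f : Phase) (v : V)
  | done (v : V)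

section

variable {V : Type u} {n : ℕ} {T : ObjType.{u}} (q₀ : T.State) {team : Fin n → Bool}
  (op : Fin n → T.Op) (rd : T.Op) (B : MatchBracket n team)

/-- The local state after a match that was decided for `u`. -/
def finish (s : ℕ) (u : V) : Loc V :=
  match B.next s with
  | some s' => .running s' .write u
  | none => .done u

open Classical in
/-- The local state after reading the recording object with response `r` after the beginning of
the match. -/
noncomputable def afterRead (team : Fin n → Bool) (s : ℕ) (v : V) (r : T.Resp) : Loc V :=
  .running s (.fetch (decide (∃ q ∈ T.FirstBy op team q₀ true, T.resp q rd = r))) v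

/-- The types of the shared objects. -/
def kind (V : Type u) (T : ObjType.{u}) : Cell → ObjType.{u}
  | .obj _ => T
  | .reg _ _ => registerType (Option V)

open Classical in
/-- The program of the tournament. In each match a process announces its value in the register of
its team, applies the operation of its role to the recording object if this is still in its
initial state, finds out which team was first, and adopts the value in the register of that team.
If team `true` may restore the initial state, the only member of team `false` gives up when it sees
a value of the other team. -/
noncomputable def action (p : Fin n) : Loc V → NextAction V (kind V T) (Loc V)
  | .done v => .output v
  | .running s .write v => .invoke (.reg s (team (B.role s p))) (RegOp.write (some v))
      fun _ => .running s .look v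
  | .running s .look v => .invoke (.obj s) rd fun r =>
      if r = T.resp q₀ rd then
        if q₀ ∈ T.FirstBy op team q₀ true ∧ team (B.role s p) = false then .running s .check v
        else .running s .apply v
      else afterRead q₀ op rd team s v r
  | .running s .check v => .invoke (.reg s true) RegOp.read fun r =>
      match Option.join r with
      | some u => finish B s u
      | none => .running s .apply v
  | .running s .apply v => .invoke (.obj s) (op (B.role s p)) fun _ => .running s .relook v
  | .running s .relook v => .invoke (.obj s) rd fun r => afterRead q₀ op rd team s v r
  | .running s (.fetch X) v => .invoke (.reg s X) RegOp.read fun r =>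
      -- The default is never used: the register of the winning team is written before the match is
      -- decided.
      finish B s ((Option.join r).getD v)

/-- The tournament algorithm. -/
noncomputable def algorithm {𝒯 : Set ObjType.{u}} (hT : T ∈ 𝒯 ∪ registers) :
    Algorithm V (𝒯 ∪ registers) n where
  Obj := Cell
  kind := kind V T
  kind_mem
    | .obj _ => hT
    | .reg _ _ => .inr ⟨_, rfl⟩
  initShared
    | .obj _ => q₀
    | .reg _ _ => (none : Option V)
  Loc := Loc V
  initLocal p v := .running (B.entry p) .write v
  action := action q₀ op rd B

/-! ### Safety -/

/-- The value that a team proposes in a match, given the decisions of all matches. -/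
def proposal (input : Fin n → V) (d : ℕ → Option (Bool × V)) (s : ℕ) (X : Bool) : Option V :=
  match B.src s X with
  | .inl s' => (d s').map Prod.snd
  | .inr p => some (input p)

theorem proposal_mono {input : Fin n → V} {d d' : ℕ → Option (Bool × V)}
    (hd : ∀ s x, d s = some x → d' s = some x) {s : ℕ} {X : Bool} {u : V}
    (h : proposal B input d s X = some u) : proposal B input d' s X = some u := by
  unfold proposal at h ⊢
  split at h
  · obtain ⟨x, hx, rfl⟩ := Option.map_eq_some_iff.mp h
    simp [hd _ _ hx]
  · exact h

/-- The invariant of a process. -/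
def LocInv (input : Fin n → V) (reg : ℕ → Bool → Option V) (L : ℕ → List (Fin n))
    (d : ℕ → Option (Bool × V)) (p : Fin n) : Loc V → Prop
  | .running s f v => B.Mem s p ∧ proposal B input d s (team (B.role s p)) = some v ∧
      T.PhaseInv q₀ team op (L s) (d s) (reg s) (B.role s p) v f
  | .done v => ∃ s X, B.next s = none ∧ d s = some (X, v)

/-- The invariant of a configuration, given the roles that have accessed the object of each match
since it was in its initial state, and the decisions of all matches. -/
structure Inv (input : Fin n → V) (loc : Fin n → Loc V) (obj : ℕ → T.State)
    (reg : ℕ → Bool → Option V) (L : ℕ → List (Fin n)) (d : ℕ → Option (Bool × V)) : Prop where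
  loc : ∀ p, LocInv q₀ op B input reg L d p (loc p)
  game : ∀ s, T.MatchInv q₀ team op (proposal B input d s) (obj s) (L s) (d s) (reg s)
  valid : ∀ s x, d s = some x → ∃ p, x.2 = input p

variable {q₀ op rd B} {input : Fin n → V} {loc loc' : Fin n → Loc V} {obj obj' : ℕ → T.State}
  {reg reg' : ℕ → Bool → Option V} {L : ℕ → List (Fin n)} {d : ℕ → Option (Bool × V)}

/-- A step that affects just one match preserves the invariant if it does so locally. -/
theorem Inv.update (h : Inv q₀ op B input loc obj reg L d) {p : Fin n} {s : ℕ} {f : Phase} {v : V}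
    (hp : loc p = .running s f v) (hloc : ∀ q, q ≠ p → loc' q = loc q)
    (hobj : ∀ t, t ≠ s → obj' t = obj t) (hreg : ∀ t, t ≠ s → reg' t = reg t) {L' : List (Fin n)}
    {d' : Option (Bool × V)} (hd : ∀ x, d s = some x → d' = some x)
    (hgame : T.MatchInv q₀ team op (proposal B input d s) (obj' s) L' d' (reg' s))
    (hother : ∀ j w f, j ≠ B.role s p → proposal B input d s (team j) = some w →
      T.PhaseInv q₀ team op (L s) (d s) (reg s) j w f → T.PhaseInv q₀ team op L' d' (reg' s) j w f)
    (hself : (∃ f', loc' p = .running s f' v ∧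
        T.PhaseInv q₀ team op L' d' (reg' s) (B.role s p) v f') ∨
      ∃ X u, loc' p = finish B s u ∧ d' = some (X, u)) :
    (∀ t x, d t = some x → Function.update d s d' t = some x) ∧
      Inv q₀ op B input loc' obj' reg' (Function.update L s L') (Function.update d s d') := by
  have hle : ∀ t x, d t = some x → Function.update d s d' t = some x := by
    intro t x hx
    by_cases ht : t = s
    · subst ht; rw [Function.update_self]; exact hd x hx
    · rwa [Function.update_of_ne ht]
  have hpinv := h.loc p
  rw [hp] at hpinv
  refine ⟨hle, ⟨fun q => ?_, fun t => ?_, fun t x hx => ?_⟩⟩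
  · by_cases hq : q = p
    · subst hq
      rcases hself with ⟨f', hf', hinv⟩ | ⟨X, u, hfin, hdec⟩
      · rw [hf']
        refine ⟨hpinv.1, proposal_mono B hle hpinv.2.1, ?_⟩
        rwa [Function.update_self, Function.update_self]
      · rw [hfin, finish]
        cases hnext : B.next s with
        | none => exact ⟨s, X, hnext, by rw [Function.update_self, hdec]⟩
        | some s' =>
          refine ⟨B.mem_next hpinv.1 hnext, ?_, trivial⟩
          rw [proposal, B.src_next hpinv.1 hnext]
          simp [hdec]
    · rw [hloc q hq]
      have hqinv := h.loc q
      cases hl : loc q with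
      | done w =>
        rw [hl] at hqinv
        obtain ⟨t, X, ht, hX⟩ := hqinv
        exact ⟨t, X, ht, hle _ _ hX⟩
      | running t g w =>
        rw [hl] at hqinv
        obtain ⟨h1, h2, h3⟩ := hqinv
        refine ⟨h1, proposal_mono B hle h2, ?_⟩
        by_cases ht : t = s
        · subst ht
          rw [Function.update_self, Function.update_self]
          exact hother _ w g (fun hr => hq (B.role_inj h1 hpinv.1 hr)) h2 h3
        · rwa [Function.update_of_ne ht, Function.update_of_ne ht, hreg t ht]
  · by_cases ht : t = s
    · subst ht
      rw [Function.update_self, Function.update_self]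
      exact hgame.mono fun X u => proposal_mono B hle
    · rw [Function.update_of_ne ht, Function.update_of_ne ht, hreg t ht, hobj t ht]
      exact (h.game t).mono fun X u => proposal_mono B hle
  · by_cases ht : t = s
    · subst ht
      rw [Function.update_self] at hx
      have hprop := hgame.proposed x.1 x.2 hx
      unfold proposal at hprop
      split at hprop
      · obtain ⟨y, hy, hyx⟩ := Option.map_eq_some_iff.mp hprop
        rw [← hyx]
        exact h.valid _ _ hy
      · exact ⟨_, (Option.some.inj hprop).symm⟩
    · rw [Function.update_of_ne ht] at hx
      exact h.valid t x hx

open Classical in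
theorem afterRead_eq (hrd : Function.Injective fun q => T.resp q rd) (s : ℕ) (v : V)
    (q : T.State) : afterRead q₀ op rd team s v (T.resp q rd) =
      .running s (.fetch (decide (q ∈ T.FirstBy op team q₀ true))) v := by
  have : (∃ q' ∈ T.FirstBy op team q₀ true, T.resp q' rd = T.resp q rd) ↔
      q ∈ T.FirstBy op team q₀ true := by
    constructor
    · rintro ⟨q', hq', heq⟩
      rwa [← hrd heq]
    · exact fun hq => ⟨q, hq, rfl⟩
  simp only [afterRead, this]

variable {𝒯 : Set ObjType.{u}} {hT : T ∈ 𝒯 ∪ registers}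

/-- The local states in a configuration of the tournament algorithm. -/
def locs (c : (algorithm (V := V) q₀ op rd B hT).Config) (p : Fin n) : Loc V := c.loc p

/-- The states of the recording objects. -/
def objs (c : (algorithm (V := V) q₀ op rd B hT).Config) (s : ℕ) : T.State := c.shared (.obj s)

/-- The contents of the registers. -/
def regs (c : (algorithm (V := V) q₀ op rd B hT).Config) (s : ℕ) (X : Bool) : Option V :=
  c.shared (.reg s X)

/-! ### Effect of each kind of operation on the tournament memory -/

section Steps

variable {c : (algorithm (V := V) q₀ op rd B hT).Config} {p : Fin n} {s : ℕ} {X : Bool}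

theorem locs_step_of_ne {q : Fin n} (hq : q ≠ p) :
    locs ((algorithm q₀ op rd B hT).exec input c (.step p)) q = locs c q :=
  Algorithm.exec_step_loc_of_ne _ input c hq

theorem step_obj {o : T.Op} {k : T.Resp → Loc V}
    (h : action q₀ op rd B p (locs c p) = .invoke (.obj s) o k) :
    locs ((algorithm q₀ op rd B hT).exec input c (.step p)) p = k (T.resp (objs c s) o) ∧
      objs ((algorithm q₀ op rd B hT).exec input c (.step p)) s = T.next (objs c s) o ∧
      (∀ t, t ≠ s → objs ((algorithm q₀ op rd B hT).exec input c (.step p)) t = objs c t) ∧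
      regs ((algorithm q₀ op rd B hT).exec input c (.step p)) = regs c := by
  let A := algorithm (V := V) q₀ op rd B hT
  have hact : A.action p (c.loc p) = .invoke (.obj s) o k := h
  refine ⟨A.exec_step_loc_self input hact, A.exec_step_shared_self input hact, fun t ht => ?_, ?_⟩
  · exact A.exec_step_shared_of_ne input hact fun h => ht (Cell.obj.inj h)
  · funext t Y
    exact A.exec_step_shared_of_ne input hact fun h => nomatch h

theorem step_write {a : Option V} {k : Option (Option V) → Loc V}
    (h : action q₀ op rd B p (locs c p) = .invoke (.reg s X) (RegOp.write a) k) :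
    locs ((algorithm q₀ op rd B hT).exec input c (.step p)) p = k none ∧
      objs ((algorithm q₀ op rd B hT).exec input c (.step p)) = objs c ∧
      regs ((algorithm q₀ op rd B hT).exec input c (.step p)) s =
        Function.update (regs c s) X a ∧
      ∀ t, t ≠ s → regs ((algorithm q₀ op rd B hT).exec input c (.step p)) t = regs c t := by
  let A := algorithm (V := V) q₀ op rd B hT
  have hact : A.action p (c.loc p) = .invoke (.reg s X) (RegOp.write a) k := h
  refine ⟨A.exec_step_loc_self input hact, ?_, ?_, fun t ht => ?_⟩
  · funext t
    exact A.exec_step_shared_of_ne input hact fun h => nomatch h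
  · funext Y
    by_cases hY : Y = X
    · subst hY
      rw [Function.update_self]
      exact A.exec_step_shared_self input hact
    · rw [Function.update_of_ne hY]
      exact A.exec_step_shared_of_ne input hact fun h => hY (Cell.reg.inj h).2
  · funext Y
    exact A.exec_step_shared_of_ne input hact fun h => ht (Cell.reg.inj h).1

theorem step_read {k : Option (Option V) → Loc V}
    (h : action q₀ op rd B p (locs c p) = .invoke (.reg s X) RegOp.read k) :
    locs ((algorithm q₀ op rd B hT).exec input c (.step p)) p = k (some (regs c s X)) ∧
      objs ((algorithm q₀ op rd B hT).exec input c (.step p)) = objs c ∧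
      regs ((algorithm q₀ op rd B hT).exec input c (.step p)) = regs c := by
  let A := algorithm (V := V) q₀ op rd B hT
  have hact : A.action p (c.loc p) = .invoke (.reg s X) RegOp.read k := h
  refine ⟨A.exec_step_loc_self input hact, ?_, ?_⟩
  · funext t
    exact A.exec_step_shared_of_ne input hact fun h => nomatch h
  · funext t Y
    by_cases hY : Cell.reg t Y = Cell.reg s X
    · obtain ⟨rfl, rfl⟩ := Cell.reg.inj hY
      exact A.exec_step_shared_self input hact
    · exact A.exec_step_shared_of_ne input hact hY

end Steps

variable (q₀ op rd B) in
/-- The invariant of a configuration of the tournament algorithm. -/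
def ConfigInv (hT : T ∈ 𝒯 ∪ registers) (input : Fin n → V)
    (c : (algorithm (V := V) q₀ op rd B hT).Config)
    (L : ℕ → List (Fin n)) (d : ℕ → Option (Bool × V)) : Prop :=
  Inv q₀ op B input (locs c) (objs c) (regs c) L d

theorem configInv_initial : ConfigInv q₀ op rd B hT input
    ((algorithm q₀ op rd B hT).initial input) (fun _ => []) (fun _ => none) where
  loc p := ⟨B.mem_entry p, by simp [proposal, B.src_entry], trivial⟩
  game s :=
    { nodup := List.nodup_nil
      state := rfl
      head := by simp
      proposed := by simp
      written := by simp
      dec_nil := by simp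
      reg := fun X u h => nomatch (show (none : Option V) = some u from h) }
  valid := by simp

theorem ConfigInv.crash {c : (algorithm (V := V) q₀ op rd B hT).Config}
    (h : ConfigInv q₀ op rd B hT input c L d) (p : Fin n) :
    ConfigInv q₀ op rd B hT input ((algorithm q₀ op rd B hT).exec input c (.crash p)) L d := by
  let A := algorithm (V := V) q₀ op rd B hT
  have hobj : objs (A.exec input c (.crash p)) = objs c :=
    funext fun s => congrFun (A.exec_crash_shared input c p) (.obj s)
  have hreg : regs (A.exec input c (.crash p)) = regs c :=
    funext fun s => funext fun X => congrFun (A.exec_crash_shared input c p) (.reg s X)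
  unfold ConfigInv
  rw [hobj, hreg]
  refine ⟨fun q => ?_, h.game, h.valid⟩
  by_cases hq : q = p
  · subst hq
    rw [show locs (A.exec input c (.crash q)) q = .running (B.entry q) .write (input q) from
      A.exec_crash_loc_self input c q]
    exact ⟨B.mem_entry q, by simp [proposal, B.src_entry], trivial⟩
  · rw [show locs (A.exec input c (.crash p)) q = locs c q from A.exec_crash_loc_of_ne input c hq]
    exact h.loc q

/-- A step that reads a shared object preserves the invariant if it does so locally. -/
theorem ConfigInv.update_read {c c' : (algorithm (V := V) q₀ op rd B hT).Config}
    (h : ConfigInv q₀ op rd B hT input c L d) {p : Fin n} {s : ℕ} {f : Phase} {v : V}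
    (hp : locs c p = .running s f v) (hloc : ∀ q, q ≠ p → locs c' q = locs c q)
    (hobj : objs c' = objs c) (hreg : regs c' = regs c)
    {L' : List (Fin n)} {d' : Option (Bool × V)} (hd : ∀ x, d s = some x → d' = some x)
    (hgame : T.MatchInv q₀ team op (proposal B input d s) (objs c s) L' d' (regs c s))
    (hother : ∀ j w f, j ≠ B.role s p →
      T.PhaseInv q₀ team op (L s) (d s) (regs c s) j w f →
        T.PhaseInv q₀ team op L' d' (regs c s) j w f)
    (hself : (∃ f', locs c' p = .running s f' v ∧
        T.PhaseInv q₀ team op L' d' (regs c s) (B.role s p) v f') ∨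
      ∃ X u, locs c' p = finish B s u ∧ d' = some (X, u)) :
    ∃ L' d', (∀ s x, d s = some x → d' s = some x) ∧ ConfigInv q₀ op rd B hT input c' L' d' :=
  ⟨_, _, Inv.update h hp hloc (fun t _ => congrFun hobj t) (fun t _ => congrFun hreg t) hd
    (by rwa [hobj, hreg]) (by rw [hreg]; exact fun j w f hj _ => hother j w f hj) (by rwa [hreg])⟩

open Classical in
theorem ConfigInv.step (hrec : T.IsRecording q₀ team op) (hread : ∀ q, T.next q rd = q)
    (hrd : Function.Injective fun q => T.resp q rd)
    {c : (algorithm (V := V) q₀ op rd B hT).Config}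
    (h : ConfigInv q₀ op rd B hT input c L d) (p : Fin n) :
    ∃ L' d', (∀ s x, d s = some x → d' s = some x) ∧
      ConfigInv q₀ op rd B hT input ((algorithm q₀ op rd B hT).exec input c (.step p)) L' d' := by
  have hloc : ∀ q, q ≠ p →
      locs ((algorithm q₀ op rd B hT).exec input c (.step p)) q = locs c q :=
    fun q hq => locs_step_of_ne hq
  have hinv := h.loc p
  cases hp : locs c p with
  | done v =>
    have hact : (algorithm (V := V) q₀ op rd B hT).action p (c.loc p) = .output v :=
      congrArg (action q₀ op rd B p) hp
    rw [Algorithm.exec_step_of_output _ input hact]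
    exact ⟨L, d, fun _ _ => id, h⟩
  | running s f v =>
    rw [hp] at hinv
    obtain ⟨hmem, hprop, hphase⟩ := hinv
    have hgame := h.game s
    have hact := congrArg (action q₀ op rd B p) hp
    cases f with
    | write =>
      obtain ⟨hl, hobj, hreg, hreg'⟩ := step_write (input := input) (hT := hT) hact
      refine ⟨_, _, Inv.update h hp hloc (fun t _ => congrFun hobj t) hreg' (L' := L s)
        (fun _ => id) ?_ ?_ (.inl ⟨.look, hl, ?_⟩)⟩
      · rw [hreg, hobj]
        exact hgame.write hprop
      · rw [hreg]
        exact fun j w f _ hw hf => hf.write hprop hw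
      · rw [hreg]
        exact Function.update_self ..
    | look =>
      obtain ⟨hl, hobj, hobj', hreg⟩ := step_obj (input := input) (hT := hT) hact
      rw [hread] at hobj
      have hobj : objs ((algorithm q₀ op rd B hT).exec input c (.step p)) = objs c :=
        funext fun t => if ht : t = s then ht ▸ hobj else hobj' t ht
      by_cases hq : objs c s = q₀
      · replace hl := hl.trans (if_pos (congrArg (fun q => T.resp q rd) hq))
        refine h.update_read hp hloc hobj hreg (fun _ => id) (hgame.reset hrec hq)
          (fun j w f _ hf => hf.reset hrec hgame hq) (.inl ?_)
        split_ifs at hl with hcheck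
        · exact ⟨.check, hl, hgame.phaseInv_check hrec hq hphase hcheck⟩
        · exact ⟨.apply, hl, hgame.phaseInv_apply hrec hq hphase hcheck⟩
      · replace hl := hl.trans (if_neg fun h => hq (hrd h))
        rw [afterRead_eq hrd] at hl
        exact h.update_read hp hloc hobj hreg (fun _ => id) hgame (fun j w f _ => id)
          (.inl ⟨_, hl, hgame.decided hrec (.inl hq)⟩)
    | check =>
      obtain ⟨hl, hobj, hreg⟩ := step_read (input := input) (hT := hT) hact
      rw [Option.join_some] at hl
      cases hr : regs c s true with
      | none =>
        rw [hr] at hl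
        exact h.update_read hp hloc hobj hreg (fun _ => id) hgame (fun j w f _ => id)
          (.inl ⟨_, hl, hgame.phaseInv_apply_of_check hr hphase⟩)
      | some u =>
        rw [hr] at hl
        obtain ⟨hd, hgame', hother⟩ := hgame.check hrec hr hphase
        exact h.update_read hp hloc hobj hreg hd hgame' hother (.inr ⟨_, u, hl, rfl⟩)
    | apply =>
      obtain ⟨hl, hobj, hobj', hreg⟩ := step_obj (input := input) (hT := hT) hact
      obtain ⟨d', hd, hsome, hgame', hother⟩ := hgame.apply hrec hphase
      refine ⟨_, _, Inv.update h hp hloc hobj' (fun t _ => congrFun hreg t)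
        (L' := L s ++ [B.role s p]) hd ?_ ?_ (.inl ⟨.relook, hl, hsome⟩)⟩
      · rw [hreg, hobj]; exact hgame'
      · rw [hreg]; exact fun j w f hj _ => hother j w f hj
    | relook =>
      obtain ⟨hl, hobj, hobj', hreg⟩ := step_obj (input := input) (hT := hT) hact
      rw [hread] at hobj
      have hobj : objs ((algorithm q₀ op rd B hT).exec input c (.step p)) = objs c :=
        funext fun t => if ht : t = s then ht ▸ hobj else hobj' t ht
      rw [afterRead_eq hrd] at hl
      exact h.update_read hp hloc hobj hreg (fun _ => id) hgame (fun j w f _ => id)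
        (.inl ⟨_, hl, hgame.decided hrec (.inr hphase)⟩)
    | fetch X =>
      obtain ⟨u, hu⟩ := hphase
      obtain ⟨hl, hobj, hreg⟩ := step_read (input := input) (hT := hT) hact
      rw [hgame.written X u hu] at hl
      exact h.update_read hp hloc hobj hreg (fun _ => id) hgame (fun j w f _ => id)
        (.inr ⟨X, u, hl, hu⟩)

/-! ### Termination -/

/-- A bound on the number of steps that a process takes in a match. -/
def phaseRank : Phase → ℕ
  | .write => 6
  | .look => 5
  | .check => 4
  | .apply => 3
  | .relook => 2
  | .fetch _ => 1

variable (B) in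
/-- A bound on the number of steps that a process takes before it returns a value. -/
def rank : Loc V → ℕ
  | .running s f _ => 6 * B.height s + phaseRank f
  | .done _ => 0

/-- The next match is lower by at least one, which frees six units, just enough for its six phases;
the phase just left still counts at least one. -/
theorem rank_finish_lt (s : ℕ) (f : Phase) (u v : V) :
    rank B (finish B s u) < rank B (.running s f v) := by
  have hf : 0 < phaseRank f := by cases f <;> simp [phaseRank]
  unfold finish
  cases hs : B.next s with
  | none => simp only [rank]; omega
  | some s' =>
    have := B.height_lt hs
    have h6 : phaseRank .write = 6 := rfl
    simp only [rank, h6]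
    omega

theorem rank_running_lt {f f' : Phase} (s : ℕ) (u v : V) (h : phaseRank f' < phaseRank f) :
    rank B (.running s f' u) < rank B (.running s f v) :=
  Nat.add_lt_add_left h _

theorem rank_step_lt {c : (algorithm (V := V) q₀ op rd B hT).Config} {p : Fin n}
    (h : ∀ v, locs c p ≠ .done v) :
    rank B (locs ((algorithm (V := V) q₀ op rd B hT).exec input c (.step p)) p) <
      rank B (locs c p) := by
  cases hp : locs c p with
  | done v => exact absurd hp (h v)
  | running s f v =>
    have hact := congrArg (action q₀ op rd B p) hp
    cases f with
    | write =>
      rw [(step_write hact).1]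
      exact rank_running_lt _ _ _ (by decide)
    | look =>
      rw [(step_obj hact).1]
      split_ifs <;> exact rank_running_lt _ _ _ (by simp [phaseRank])
    | check =>
      rw [(step_read hact).1]
      split
      · exact rank_finish_lt _ _ _ _
      · exact rank_running_lt _ _ _ (by decide)
    | apply =>
      rw [(step_obj hact).1]
      exact rank_running_lt _ _ _ (by decide)
    | relook =>
      rw [(step_obj hact).1]
      exact rank_running_lt _ _ _ (by simp [phaseRank])
    | fetch X =>
      rw [(step_read hact).1]
      exact rank_finish_lt _ _ _ _

/-! ### Correctness -/

theorem done_of_outputs {σ : ℕ → Event n} {t : ℕ} {p : Fin n} {v : V}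
    (h : (algorithm (V := V) q₀ op rd B hT).Outputs input σ t p v) :
    locs ((algorithm (V := V) q₀ op rd B hT).config input σ t) p = .done v := by
  change action q₀ op rd B p (locs _ p) = _ at h
  cases hp : locs ((algorithm (V := V) q₀ op rd B hT).config input σ t) p with
  | done w =>
    rw [hp] at h
    exact congrArg _ (NextAction.output.inj h)
  | running s f w =>
    rw [hp] at h
    cases f <;> exact nomatch h

/-- The invariant holds along the whole execution with decisions that are never revised. Agreement
follows, since outputs are decisions of the unique final match. -/
theorem exists_decisions (hrec : T.IsRecording q₀ team op) (hread : ∀ q, T.next q rd = q)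
    (hrd : Function.Injective fun q => T.resp q rd) (hT : T ∈ 𝒯 ∪ registers) (input : Fin n → V)
    (σ : ℕ → Event n) : ∃ d : ℕ → ℕ → Option (Bool × V),
      (∀ t t' s x, t ≤ t' → d t s = some x → d t' s = some x) ∧
      (∀ t s x, d t s = some x → ∃ p, x.2 = input p) ∧
      ∀ t p v, (algorithm q₀ op rd B hT).Outputs input σ t p v →
        ∃ s X, B.next s = none ∧ d t s = some (X, v) := by
  let A := algorithm (V := V) q₀ op rd B hT
  have hstep : ∀ (t : ℕ) (x : (ℕ → List (Fin n)) × (ℕ → Option (Bool × V))),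
      ConfigInv q₀ op rd B hT input (A.config input σ t) x.1 x.2 →
      ∃ y : (ℕ → List (Fin n)) × (ℕ → Option (Bool × V)),
        (∀ s z, x.2 s = some z → y.2 s = some z) ∧
        ConfigInv q₀ op rd B hT input (A.config input σ (t + 1)) y.1 y.2 := by
    intro t x hx
    change ∃ y : (ℕ → List (Fin n)) × (ℕ → Option (Bool × V)), _ ∧
      ConfigInv q₀ op rd B hT input (A.exec input (A.config input σ t) (σ t)) y.1 y.2
    cases σ t with
    | crash p => exact ⟨x, fun _ _ => id, hx.crash p⟩
    | step p =>
      obtain ⟨L', d', hd, h'⟩ := hx.step hrec hread hrd p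
      exact ⟨(L', d'), hd, h'⟩
  choose! next hnext hinv using hstep
  let ghost : ℕ → (ℕ → List (Fin n)) × (ℕ → Option (Bool × V)) := fun t =>
    Nat.rec (fun _ => [], fun _ => none) (fun t x => next t x) t
  have hghost : ∀ t, ConfigInv q₀ op rd B hT input (A.config input σ t) (ghost t).1 (ghost t).2 := by
    intro t
    induction t with
    | zero => exact configInv_initial
    | succ t ih => exact hinv t _ ih
  refine ⟨fun t => (ghost t).2, ?_, fun t => (hghost t).valid, ?_⟩
  · intro t t' s x ht
    induction t', ht using Nat.le_induction with
    | base => exact id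
    | succ t' _ ih => exact fun hx => hnext t' _ (hghost t') s x (ih hx)
  · intro t p v hv
    have := (hghost t).loc p
    rw [done_of_outputs hv] at this
    exact this

theorem solvesRC (hrec : T.IsRecording q₀ team op) (hread : ∀ q, T.next q rd = q)
    (hrd : Function.Injective fun q => T.resp q rd) (hT : T ∈ 𝒯 ∪ registers) :
    (algorithm (V := V) q₀ op rd B hT).SolvesRC where
  agreement input σ s t p q v w hv hw := by
    obtain ⟨d, hmono, -, hout⟩ := exists_decisions (B := B) hrec hread hrd hT input σ
    obtain ⟨i, X, hi, hX⟩ := hout s p v hv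
    obtain ⟨j, Y, hj, hY⟩ := hout t q w hw
    obtain rfl := B.final hi hj
    have h1 := hmono _ _ _ _ (le_max_left s t) hX
    rw [hmono _ _ _ _ (le_max_right s t) hY] at h1
    exact (Prod.mk.inj (Option.some.inj h1)).2.symm
  validity input σ t p v hv := by
    obtain ⟨d, -, hvalid, hout⟩ := exists_decisions (B := B) hrec hread hrd hT input σ
    obtain ⟨s, X, -, hX⟩ := hout t p v hv
    exact hvalid _ _ _ hX
  waitFree input σ p t₀ hcrash hinf := by
    by_contra! hno
    let A := algorithm (V := V) q₀ op rd B hT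
    let r : ℕ → ℕ := fun t => rank B (locs (A.config input σ t) p)
    have hrun : ∀ t, t₀ ≤ t → ∀ v, locs (A.config input σ t) p ≠ .done v := fun t ht v hv =>
      hno t v ht (congrArg (action q₀ op rd B p) hv)
    have hlt : ∀ t, t₀ ≤ t → σ t = .step p → r (t + 1) < r t := by
      intro t ht hσ
      change rank B (locs (A.exec input (A.config input σ t) (σ t)) p) < _
      rw [hσ]
      exact rank_step_lt (hrun t ht)
    have hle : ∀ t, t₀ ≤ t → r (t + 1) ≤ r t := by
      intro t ht
      by_cases hσ : σ t = .step p
      · exact (hlt t ht hσ).le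
      · refine le_of_eq (congrArg (rank B) ?_)
        change locs (A.exec input (A.config input σ t) (σ t)) p = _
        cases he : σ t with
        | step q => exact locs_step_of_ne fun h => hσ (h ▸ he)
        | crash q => exact A.exec_crash_loc_of_ne input _ fun h => hcrash t ht (h ▸ he)
    have hanti : Antitone fun k => r (t₀ + k) :=
      antitone_nat_of_succ_le fun k => hle (t₀ + k) (Nat.le_add_right _ _)
    -- From `t₀` on the rank never increases, and each own step lowers it; a step after the minimum
    -- is impossible.
    obtain ⟨_, ⟨k, rfl⟩, hk⟩ := WellFounded.has_min wellFounded_lt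
      (Set.range fun k => r (t₀ + k)) ⟨_, 0, rfl⟩
    obtain ⟨t, ht, hkt⟩ := hinf.exists_gt (t₀ + k)
    obtain ⟨j, rfl⟩ := Nat.exists_eq_add_of_le hkt.le
    have h1 := hlt _ (by omega) ht
    have h2 := hanti (Nat.le_add_right k j)
    have h3 := hk _ ⟨k + j + 1, rfl⟩
    simp only [← add_assoc] at h1 h2 h3
    omega

end

end Tournament

/-! ### Recoverable consensus numbers -/

/-- Brackets are built only for teams that are an initial segment and its complement, so the roles
are renumbered. -/
theorem exists_equiv_fin_threshold {ι : Type*} [Fintype ι] (team : ι → Bool)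
    (h : ∀ X, ∃ i, team i = X) : ∃ a, 0 < a ∧ a < Fintype.card ι ∧
      ∃ e : Fin (Fintype.card ι) ≃ ι, team ∘ e = fun i => decide (i.1 < a) := by
  classical
  let a := Fintype.card {i // team i = true}
  let b := Fintype.card {i // ¬ team i = true}
  have hab : a + b = Fintype.card ι := by
    rw [← Fintype.card_sum]; exact Fintype.card_congr (Equiv.sumCompl fun i => team i = true)
  have ha : 0 < a := Fintype.card_pos_iff.mpr (let ⟨i, hi⟩ := h true; ⟨⟨i, hi⟩⟩)
  have hb : 0 < b := Fintype.card_pos_iff.mpr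
    (let ⟨i, hi⟩ := h false; ⟨⟨i, by simp [hi]⟩⟩)
  let e : Fin (a + b) ≃ ι := finSumFinEquiv.symm.trans
    (((Fintype.equivFin _).symm.sumCongr (Fintype.equivFin _).symm).trans
      (Equiv.sumCompl fun i => team i = true))
  refine ⟨a, ha, by omega, (finCongr hab.symm).trans e, ?_⟩
  funext i
  obtain ⟨x, rfl⟩ : ∃ x, i = finCongr hab (finSumFinEquiv x) :=
    ⟨finSumFinEquiv.symm ((finCongr hab).symm i), by simp⟩
  cases x with
  | inl x =>
    have := ((Fintype.equivFin {i // team i = true}).symm x).2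
    simpa [e] using this
  | inr x =>
    have := ((Fintype.equivFin {i // ¬ team i = true}).symm x).2
    simpa [e] using this

section

variable {V : Type u} {𝒯 𝒯' : Set ObjType.{u}}

theorem ObjType.IsRecording.rcSolvable {T : ObjType.{u}} {ι : Type*} [Fintype ι] {q₀ : T.State}
    {team : ι → Bool} {op : ι → T.Op} (hrec : T.IsRecording q₀ team op) (hread : T.Readable)
    (hT : T ∈ 𝒯 ∪ registers) : RCSolvable V 𝒯 (Fintype.card ι) := by
  obtain ⟨a, ha, han, e, he⟩ := exists_equiv_fin_threshold team hrec.nonempty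
  obtain ⟨rd, hrd, hinj⟩ := hread
  have hrec' := hrec.comp_equiv e
  rw [he] at hrec'
  exact ⟨_, Tournament.solvesRC (B := .ofThreshold ha han) hrec' hrd hinj hT⟩

theorem readable_of_mem_registers {T : ObjType.{u}} (hT : T ∈ registers) : T.Readable := by
  obtain ⟨α, rfl⟩ := hT
  exact ⟨RegOp.read, fun _ => rfl, fun q q' h => Option.some.inj h⟩

/-- A process that runs alone returns its input. -/
theorem rcSolvable_one : RCSolvable V 𝒯 1 := by
  let A : Algorithm V (𝒯 ∪ registers) 1 :=
    { Obj := PEmpty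
      kind := fun o => o.elim
      kind_mem := fun o => o.elim
      initShared := fun o => o.elim
      Loc := V
      initLocal := fun _ v => v
      action := fun _ v => .output v }
  have hloc : ∀ (input : Fin 1 → V) σ t p, (A.config input σ t).loc p = input p := by
    intro input σ t
    induction t with
    | zero => exact fun _ => rfl
    | succ t ih =>
      intro p
      change (A.exec input (A.config input σ t) (σ t)).loc p = _
      cases σ t with
      | step q => rw [A.exec_step_of_output input (v := (A.config input σ t).loc q) rfl, ih]
      | crash q =>
        obtain rfl := Subsingleton.elim p q
        exact A.exec_crash_loc_self input _ p
  have hout : ∀ (input : Fin 1 → V) σ t p v, A.Outputs input σ t p v → v = input p := by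
    intro input σ t p v h
    rw [← hloc input σ t p]
    exact (NextAction.output.inj h).symm
  refine ⟨A, ?_, ?_, ?_⟩
  · intro input σ s t p q v w hv hw
    rw [hout _ _ _ _ _ hv, hout _ _ _ _ _ hw, Subsingleton.elim p q]
  · exact fun input σ t p v hv => ⟨p, hout _ _ _ _ _ hv⟩
  · exact fun input σ p t₀ _ _ => ⟨t₀, _, le_rfl, rfl⟩

theorem RCSolvable.mono (h : 𝒯 ⊆ 𝒯') {n : ℕ} (hs : RCSolvable V 𝒯 n) : RCSolvable V 𝒯' n := by
  obtain ⟨A, hA⟩ := hs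
  let A' : Algorithm V (𝒯' ∪ registers) n :=
    { Obj := A.Obj
      kind := A.kind
      kind_mem := fun o => Set.union_subset_union_left _ h (A.kind_mem o)
      initShared := A.initShared
      Loc := A.Loc
      initLocal := A.initLocal
      action := A.action }
  let f : A.Config → A'.Config := fun c => ⟨c.loc, c.shared⟩
  have hexec : ∀ input c e, A'.exec input (f c) e = f (A.exec input c e) := by
    intro input c e
    cases e with
    | crash p => rfl
    | step p =>
      have hact : A'.action p ((f c).loc p) = A.action p (c.loc p) := rfl
      cases hp : A.action p (c.loc p) with
      | output v =>
        rw [A.exec_step_of_output input hp, A'.exec_step_of_output input (hact.trans hp)]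
      | invoke o op k =>
        simp only [Algorithm.exec, hact, hp]
        rfl
  have hconfig : ∀ input σ t, A'.config input σ t = f (A.config input σ t) := by
    intro input σ t
    induction t with
    | zero => rfl
    | succ t ih => simp only [Algorithm.config, ih, hexec]
  have hout : ∀ input σ t p v, A'.Outputs input σ t p v ↔ A.Outputs input σ t p v := by
    intro input σ t p v
    rw [Algorithm.Outputs, hconfig]
    rfl
  refine ⟨A', ?_, ?_, ?_⟩
  · intro input σ s t p q v w hv hw
    exact hA.agreement input σ s t p q v w ((hout _ _ _ _ _).mp hv) ((hout _ _ _ _ _).mp hw)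
  · exact fun input σ t p v hv => hA.validity input σ t p v ((hout _ _ _ _ _).mp hv)
  · intro input σ p t₀ hcrash hinf
    obtain ⟨t, v, ht, hv⟩ := hA.waitFree input σ p t₀ hcrash hinf
    exact ⟨t, v, ht, (hout _ _ _ _ _).mpr hv⟩

theorem RCSolvable.le_rcons {n : ℕ} (h : RCSolvable V 𝒯 n) : (n : ℕ∞) ≤ rcons V 𝒯 :=
  le_sSup ⟨n, rfl, h⟩

theorem rcons_mono (h : 𝒯 ⊆ 𝒯') : rcons V 𝒯 ≤ rcons V 𝒯' := by
  refine sSup_le ?_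
  rintro _ ⟨n, rfl, hn⟩
  exact (hn.mono h).le_rcons

/-- If a set of readable types solves recoverable consensus, then one of its types suffices for all
processes but one. -/
theorem exists_rcSolvable_singleton [Nontrivial V] (h𝒯 : 𝒯.Nonempty)
    (hread : ∀ T ∈ 𝒯, T.Readable) {n : ℕ} (h : RCSolvable V 𝒯 (n + 1)) :
    ∃ T ∈ 𝒯, (n : ℕ∞) ≤ rcons V {T} := by
  obtain ⟨T₀, hT₀⟩ := h𝒯
  by_cases hn : n ≤ 1
  · exact ⟨T₀, hT₀, le_trans (by exact_mod_cast hn) (rcSolvable_one (V := V)).le_rcons⟩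
  obtain ⟨A, hA⟩ := h
  obtain ⟨o, q, x, team, op, hrec⟩ := hA.exists_isRecording (by omega)
  have hcard : Fintype.card {i // i ≠ x} = n := by simp
  rcases A.kind_mem o with ho | ho
  · have := (hrec.rcSolvable (V := V) (hread _ ho) (𝒯 := {A.kind o}) (.inl rfl)).le_rcons
    rw [hcard] at this
    exact ⟨_, ho, this⟩
  -- The recording object may be a register; registers are always available, so any member of `𝒯`
  -- serves.
  · have := (hrec.rcSolvable (V := V) (readable_of_mem_registers ho) (𝒯 := {T₀})
      (.inr ho)).le_rcons
    rw [hcard] at this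
    exact ⟨T₀, hT₀, this⟩

end

theorem theorem9 (V : Type u) [Nontrivial V] (𝒯 : Set ObjType.{u}) (h𝒯 : 𝒯.Nonempty)
    (hread : ∀ T ∈ 𝒯, T.Readable) :
    (∀ n : ℕ∞, IsGreatest {m : ℕ∞ | ∃ T ∈ 𝒯, m = rcons V {T}} n →
      n ≤ rcons V 𝒯 ∧ rcons V 𝒯 ≤ n + 1) ∧
    ((¬ ∃ n : ℕ∞, IsGreatest {m : ℕ∞ | ∃ T ∈ 𝒯, m = rcons V {T}} n) → rcons V 𝒯 = ⊤) := by
  have hle : ∀ T ∈ 𝒯, rcons V {T} ≤ rcons V 𝒯 := fun T hT =>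
    rcons_mono (Set.singleton_subset_iff.mpr hT)
  refine ⟨?_, fun hno => ?_⟩
  · rintro n ⟨⟨T, hT, rfl⟩, hmax⟩
    refine ⟨hle T hT, sSup_le ?_⟩
    rintro _ ⟨k, rfl, hk⟩
    cases k with
    | zero => simp
    | succ k =>
      obtain ⟨T', hT', hk'⟩ := exists_rcSolvable_singleton h𝒯 hread hk
      push_cast
      exact add_le_add_left (hk'.trans (hmax ⟨T', hT', rfl⟩)) 1
  · by_contra htop
    obtain ⟨T, hT⟩ := h𝒯
    -- A finite `rcons V 𝒯` bounds all individual numbers, which are then finitely many and have a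
    -- maximum.
    have hfin : {m : ℕ∞ | ∃ T ∈ 𝒯, m = rcons V {T}}.Finite := by
      obtain ⟨N, hN⟩ := ENat.ne_top_iff_exists.mp htop
      refine ((Set.finite_Iic N).image ((↑) : ℕ → ℕ∞)).subset ?_
      rintro _ ⟨T, hT, rfl⟩
      have h1 := hle T hT
      rw [← hN] at h1
      obtain ⟨k, hk⟩ := ENat.ne_top_iff_exists.mp (h1.trans_lt (ENat.natCast_lt_top N)).ne
      rw [← hk] at h1 ⊢
      exact ⟨k, by exact_mod_cast h1, rfl⟩
    obtain ⟨m, hm⟩ := hfin.exists_maximal ⟨_, T, hT, rfl⟩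
    exact hno ⟨m, hm.1, fun x hx => (le_total x m).elim id fun h => hm.2 hx h⟩
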